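/- Let $N\in\mathbb N$ and let $H\neq\{0\}$ be a separable complex Hilbert lattice, i.e. the complexification of a real Hilbert space $E$ with a compatible vector lattice order such that $|x|\le|y|$ implies $\|x\|\le\|y\|$; the modulus of $h\in H$ is $|h|=\sup_{\theta\in\mathbb R}\operatorname{Re}(e^{i\theta}h)\in E$. A closed ideal of $H$ is a closed complex linear subspace $I$ such that $f\in I$, $g\in H$ and $|g|\le|f|$ imply $g\in I$. A closed ideal of $L^2(\mathbb R^N;H)$ is a closed complex linear subspace $\mathcal I$ such that $f\in\mathcal I$, $g\in L^2(\mathbb R^N;H)$ and $|g(x)|\le|f(x)|$ for a.e. $x$ imply $g\in\mathcal I$. A family of operators on $L^2(\mathbb R^N;H)$ is called irreducible if $\{0\}$ and $L^2(\mathbb R^N;H)$ are the only closed ideals that are invariant under every member of the family. Let $A$ be the Laplace operator on $L^2(\mathbb R^N;H)$, i.e. the operator associated with the form $a(f,g)=\int_{\mathbb R^N}(\nabla f(x)|\nabla g(x))_{H^N}\,dx$, $f,g\in H^1(\mathbb R^N;H)$: $f\in D(A)$ and $Af=g$ if and only if $f\in H^1(\mathbb R^N;H)$ and $a(f,v)=-(g|v)$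 for all $v\in H^1(\mathbb R^N;H)$. Then $A$ generates a strongly continuous semigroup $(e^{tA})_{t\ge0}$ (the heat semigroup), $iA$ generates a strongly continuous unitary group $(e^{itA})_{t\in\mathbb R}$, and the following hold. 1. The heat semigroup $(e^{tA})_{t\ge0}$ is irreducible if and only if $H=\mathbb C$ (that is, $H$ is isometrically isomorphic to $\mathbb C$ as a complex Hilbert lattice). 2. The unitary group $(e^{itA})_{t\in\mathbb R}$ is irreducible if and only if $H=\mathbb C$. 3. For every closed ideal $I$ of $H$, the space $L^2(\mathbb R^N;I)=\{f\in L^2(\mathbb R^N;H): f(x)\in I\text{ for a.e. }x\}$ is a closed ideal of $L^2(\mathbb R^N;H)$ that is invariant under $(e^{tA})_{t\ge0}$ and under $(e^{itA})_{t\in\mathbb R}$. If $H\neq\mathbb C$ and $I$ is one-dimensional, then this closed ideal is different from $\{0\}$ and from $L^2(\mathbb R^N;H)$. -/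

import Mathlib

open MeasureTheory Filter Topology
open scoped NNReal ENNReal SchwartzMap LineDeriv

/-- A complex Hilbert lattice, presented as a complex Hilbert space `H` that is the
complexification `E ⊕ iE` of a real Hilbert lattice `E`, embedded by `ofReal`. A real Hilbert
lattice is a complete real inner product space with a lattice order which is compatible with the
vector space operations and for which the norm is a lattice norm: `|x| ≤ |y| → ‖x‖ ≤ ‖y‖`. -/
structure ComplexHilbertLattice (E H : Type*)
    [NormedAddCommGroup E] [InnerProductSpace ℝ E] [CompleteSpace E]
    [Lattice E] [IsOrderedAddMonoid E] [IsOrderedModule ℝ E] [HasSolidNorm E]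
    [NormedAddCommGroup H] [InnerProductSpace ℂ H] [CompleteSpace H] where
  /-- the inclusion of the real part -/
  ofReal : E →ₗᵢ[ℝ] H
  /-- the inner product of `H` extends the one of `E` sesquilinearly -/
  inner_ofReal : ∀ x y : E, inner ℂ (ofReal x) (ofReal y) = ((inner ℝ x y : ℝ) : ℂ)
  /-- every vector has a real and an imaginary part -/
  exists_re_im : ∀ h : H, ∃ x y : E, h = ofReal x + Complex.I • ofReal y

/-- Real Hilbert lattices are Dedekind complete. -/
theorem exists_isLUB_of_hilbertLattice {E : Type*}
    [NormedAddCommGroup E] [InnerProductSpace ℝ E] [CompleteSpace E]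
    [Lattice E] [IsOrderedAddMonoid E] [IsOrderedModule ℝ E] [HasSolidNorm E]
    {S : Set E} (hS : S.Nonempty) (hb : BddAbove S) : ∃ m, IsLUB S m := by
  obtain ⟨a, ha⟩ := hS
  have hcl : IsClosed (upperBounds S) := by
    have : upperBounds S = ⋂ s ∈ S, Set.Ici s := by
      ext u; simp [upperBounds]
    rw [this]
    exact isClosed_biInter fun s _ => isClosed_Ici
  have hconv : Convex ℝ (upperBounds S) := by
    have : upperBounds S = ⋂ s ∈ S, Set.Ici s := by
      ext u; simp [upperBounds]
    rw [this]
    exact convex_iInter₂ fun s _ => convex_Ici s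
  obtain ⟨m, hm, hmin⟩ := exists_norm_eq_iInf_of_complete_convex hb hcl.isComplete hconv a
  have hproj := (norm_eq_iInf_iff_real_inner_le_zero hconv hm).1 hmin
  refine ⟨m, hm, fun u hu => ?_⟩
  have hw : m ⊓ u ∈ upperBounds S := fun s hs => le_inf (hm hs) (hu hs)
  have h1 := hproj _ hw
  have h2 : ‖m ⊓ u - a‖ ≤ ‖m - a‖ := by
    apply HasSolidNorm.solid
    rw [abs_of_nonneg (sub_nonneg.2 (hw ha)), abs_of_nonneg (sub_nonneg.2 (hm ha))]
    exact sub_le_sub_right inf_le_left a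
  have h3 : ‖m ⊓ u - a‖ ^ 2 = ‖m - a‖ ^ 2 - 2 * inner ℝ (a - m) (m ⊓ u - m)
      + ‖m ⊓ u - m‖ ^ 2 := by
    have : m ⊓ u - a = (m ⊓ u - m) - (a - m) := by abel
    rw [this, norm_sub_sq_real, real_inner_comm, norm_sub_rev m a]
    ring
  have h4 : ‖m ⊓ u - m‖ ^ 2 ≤ 0 := by
    have := pow_le_pow_left₀ (norm_nonneg _) h2 2
    linarith
  have h5 : m ⊓ u - m = 0 := by
    rw [← norm_eq_zero]
    exact pow_eq_zero_iff (two_ne_zero) |>.1 (le_antisymm h4 (sq_nonneg _))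
  rw [← sub_eq_zero.1 h5]
  exact inf_le_right

namespace ComplexHilbertLattice

variable {E H : Type*}
  [NormedAddCommGroup E] [InnerProductSpace ℝ E] [CompleteSpace E]
  [Lattice E] [IsOrderedAddMonoid E] [IsOrderedModule ℝ E] [HasSolidNorm E]
  [NormedAddCommGroup H] [InnerProductSpace ℂ H] [CompleteSpace H]

/-- The real part of a vector. -/
noncomputable def re (L : ComplexHilbertLattice E H) (h : H) : E :=
  (L.exists_re_im h).choose

theorem re_eq (L : ComplexHilbertLattice E H) (x y : E) :
    L.re (L.ofReal x + Complex.I • L.ofReal y) = x := by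
  obtain ⟨y', hy'⟩ := (L.exists_re_im (L.ofReal x + Complex.I • L.ofReal y)).choose_spec
  change L.ofReal x + Complex.I • L.ofReal y =
    L.ofReal (L.re (L.ofReal x + Complex.I • L.ofReal y)) + Complex.I • L.ofReal y' at hy'
  generalize L.re (L.ofReal x + Complex.I • L.ofReal y) = x' at hy'
  have h : L.ofReal (x' - x) = Complex.I • L.ofReal (y - y') := by
    rw [map_sub, map_sub, smul_sub, sub_eq_sub_iff_add_eq_add, add_comm _ (L.ofReal x), hy']
  have h2 := congrArg (fun v => inner ℂ (L.ofReal (x' - x)) v) h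
  simp only [inner_smul_right, L.inner_ofReal] at h2
  have h3 := congrArg Complex.re h2
  simp only [Complex.ofReal_re, Complex.mul_re, Complex.I_re, Complex.I_im, Complex.ofReal_im,
    zero_mul, mul_zero, sub_zero] at h3
  exact sub_eq_zero.1 (inner_self_eq_zero.1 h3)

theorem exists_modulus (L : ComplexHilbertLattice E H) (h : H) :
    ∃ m : E, IsLUB (Set.range fun θ : ℝ => L.re (Complex.exp (θ * Complex.I) • h)) m := by
  refine exists_isLUB_of_hilbertLattice (Set.range_nonempty _) ?_
  obtain ⟨x, y, rfl⟩ := L.exists_re_im h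
  have key : ∀ (c : ℝ) (z : E), |c| ≤ 1 → c • z ≤ |z| := by
    intro c z hc
    obtain ⟨h1, h2⟩ := abs_le.1 hc
    have e1 : c • z = ((1 + c) / 2) • z + ((1 - c) / 2) • (-z) := by module
    have e2 : |z| = ((1 + c) / 2) • |z| + ((1 - c) / 2) • |z| := by module
    rw [e1, e2]
    exact add_le_add (smul_le_smul_of_nonneg_left (le_abs_self z) (by linarith))
      (smul_le_smul_of_nonneg_left (neg_le_abs z) (by linarith))
  refine ⟨|x| + |y|, ?_⟩
  rintro _ ⟨θ, rfl⟩
  have hsmul : ∀ (c : ℝ) (v : E), (c : ℂ) • L.ofReal v = L.ofReal (c • v) := by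
    intro c v
    rw [map_smul, Complex.coe_smul]
  have e : Complex.exp (θ * Complex.I) • (L.ofReal x + Complex.I • L.ofReal y) =
      L.ofReal (Real.cos θ • x + (-Real.sin θ) • y) +
        Complex.I • L.ofReal (Real.sin θ • x + Real.cos θ • y) := by
    rw [Complex.exp_mul_I, ← Complex.ofReal_cos, ← Complex.ofReal_sin]
    simp only [map_add, ← hsmul]
    have hI : Complex.I * Complex.I = -1 := Complex.I_mul_I
    simp only [smul_add, add_smul, smul_smul, Complex.ofReal_neg]
    have h1 : (Real.cos θ + Real.sin θ * Complex.I) * Complex.I =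
        Complex.I * (Real.cos θ : ℂ) + -(Real.sin θ : ℂ) := by
      linear_combination (Real.sin θ : ℂ) * hI
    rw [h1, mul_comm (Real.sin θ : ℂ) Complex.I, add_smul]
    abel
  change L.re (Complex.exp (θ * Complex.I) • (L.ofReal x + Complex.I • L.ofReal y)) ≤ _
  rw [e, L.re_eq]
  exact add_le_add (key _ _ (Real.abs_cos_le_one θ))
    (key _ _ (by rw [abs_neg]; exact Real.abs_sin_le_one θ))

/-- The modulus `|h| = sup_θ Re (e^{iθ} h)` of a vector of a complex Hilbert lattice. -/
noncomputable def modulus (L : ComplexHilbertLattice E H) (h : H) : E :=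
  (L.exists_modulus h).choose

theorem isLUB_modulus (L : ComplexHilbertLattice E H) (h : H) :
    IsLUB (Set.range fun θ : ℝ => L.re (Complex.exp (θ * Complex.I) • h)) (L.modulus h) :=
  (L.exists_modulus h).choose_spec

/-- `H = ℂ`: the complex Hilbert lattice `H` is isomorphic to `ℂ`, by a unitary map that
preserves the modulus. -/
def IsScalar (L : ComplexHilbertLattice E H) : Prop :=
  ∃ Φ : H ≃ₗᵢ[ℂ] ℂ, ∀ h : H, Φ (L.ofReal (L.modulus h)) = ((‖Φ h‖ : ℝ) : ℂ)

/-- Closed ideals of `H`. -/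
structure IsClosedIdeal (L : ComplexHilbertLattice E H) (I : Submodule ℂ H) : Prop where
  isClosed : IsClosed (I : Set H)
  solid : ∀ f ∈ I, ∀ g : H, L.modulus g ≤ L.modulus f → g ∈ I

end ComplexHilbertLattice

/-- The Bochner space `L²(ℝ^N; H)`. -/
noncomputable abbrev BochnerL2 (N : ℕ) (H : Type*) [NormedAddCommGroup H] :=
  Lp H 2 (volume : Measure (EuclideanSpace ℝ (Fin N)))

section Lattice

variable {N : ℕ} {E H : Type*}
  [NormedAddCommGroup E] [InnerProductSpace ℝ E] [CompleteSpace E]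
  [Lattice E] [IsOrderedAddMonoid E] [IsOrderedModule ℝ E] [HasSolidNorm E]
  [NormedAddCommGroup H] [InnerProductSpace ℂ H] [CompleteSpace H]

/-- Closed ideals of `L²(ℝ^N; H)`. -/
structure IsClosedIdealL2 (L : ComplexHilbertLattice E H)
    (W : Submodule ℂ (BochnerL2 N H)) : Prop where
  isClosed : IsClosed (W : Set (BochnerL2 N H))
  solid : ∀ f ∈ W, ∀ g : BochnerL2 N H,
    (∀ᵐ x, L.modulus (g x) ≤ L.modulus (f x)) → g ∈ W

/-- `W` is invariant under all the operators `T t`. -/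
def IsInvariantUnder {ι : Type*} (T : ι → BochnerL2 N H → BochnerL2 N H)
    (W : Submodule ℂ (BochnerL2 N H)) : Prop :=
  ∀ t, ∀ f ∈ W, T t f ∈ W

/-- A family of operators on `L²(ℝ^N; H)` is irreducible if the only closed ideals invariant under
all its members are the trivial ones. -/
def IsIrreducibleFamily {ι : Type*} (L : ComplexHilbertLattice E H)
    (T : ι → BochnerL2 N H → BochnerL2 N H) : Prop :=
  ∀ W : Submodule ℂ (BochnerL2 N H),
    IsClosedIdealL2 L W → IsInvariantUnder T W → W = ⊥ ∨ W = ⊤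

end Lattice

/-- The subspace `L²(ℝ^N; I)` of those `f ∈ L²(ℝ^N; H)` with `f x ∈ I` for almost every `x`. -/
def valuedIn (N : ℕ) {H : Type*} [NormedAddCommGroup H] [InnerProductSpace ℂ H]
    (I : Submodule ℂ H) : Submodule ℂ (BochnerL2 N H) where
  carrier := {f | ∀ᵐ x, f x ∈ I}
  add_mem' := by
    intro f g hf hg
    filter_upwards [hf, hg, Lp.coeFn_add f g] with x h1 h2 h3
    rw [h3]
    exact I.add_mem h1 h2
  zero_mem' := by
    filter_upwards [Lp.coeFn_zero H 2 (volume : Measure (EuclideanSpace ℝ (Fin N)))] with x hx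
    rw [hx]
    exact I.zero_mem
  smul_mem' := by
    intro c f hf
    filter_upwards [hf, Lp.coeFn_smul c f] with x h1 h2
    rw [h2]
    exact I.smul_mem c h1

/-- `F` is the weak gradient of `f`: for every `j`, the distributional derivative of `f` in the
`j`-th coordinate direction is the function `F j ∈ L²(ℝ^N; H)`. The Sobolev space `H¹(ℝ^N; H)`
consists of all `f ∈ L²(ℝ^N; H)` that have a weak gradient in this sense. -/
def HasWeakGradient {N : ℕ} {H : Type*} [NormedAddCommGroup H] [InnerProductSpace ℂ H]
    [CompleteSpace H] (f : BochnerL2 N H) (F : Fin N → BochnerL2 N H) : Prop :=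
  ∀ j : Fin N,
    ∂_{(EuclideanSpace.single j (1 : ℝ) : EuclideanSpace ℝ (Fin N))}
      (f : 𝓢'(EuclideanSpace ℝ (Fin N), H)) = (F j : 𝓢'(EuclideanSpace ℝ (Fin N), H))

/-- The Laplace operator `A` on `L²(ℝ^N; H)`, given by its graph: it is the operator associated
with the form `a(f, v) = ∫ (∇f | ∇v)` on `H¹(ℝ^N; H)`, i.e. `f ∈ D(A)` and `A f = g` if and only
if `f ∈ H¹` and `a(f, v) = -(g | v)` for all `v ∈ H¹`. The inner product of Mathlib is
conjugate-linear in the first variable, so that `(f | v)` is `inner ℂ v f`. -/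
def IsLaplacian {N : ℕ} {H : Type*} [NormedAddCommGroup H] [InnerProductSpace ℂ H]
    [CompleteSpace H] (f g : BochnerL2 N H) : Prop :=
  ∃ F : Fin N → BochnerL2 N H, HasWeakGradient f F ∧
    ∀ (v : BochnerL2 N H) (V : Fin N → BochnerL2 N H), HasWeakGradient v V →
      ∑ j, inner ℂ (V j) (F j) = -inner ℂ v g

/-- `T` is the strongly continuous semigroup `(e^{tA})_{t ≥ 0}`, i.e. its generator is the
operator whose graph is the relation `A`. -/
structure IsSemigroupGeneratedBy {X : Type*} [NormedAddCommGroup X] [NormedSpace ℂ X]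
    (A : X → X → Prop) (T : ℝ≥0 → X →L[ℂ] X) : Prop where
  map_zero : ∀ f, T 0 f = f
  map_add : ∀ s t f, T (s + t) f = T s (T t f)
  continuous : ∀ f, Continuous fun t => T t f
  generator : ∀ f g, A f g ↔
    Tendsto (fun t : ℝ≥0 => ((t : ℝ) : ℂ)⁻¹ • (T t f - f)) (𝓝[>] 0) (𝓝 g)

/-- `U` is the strongly continuous unitary group `(e^{itA})_{t ∈ ℝ}`, i.e. its generator is `iA`,
where `A` is the operator whose graph is the relation `A`. -/
structure IsUnitaryGroupGeneratedBy {X : Type*} [NormedAddCommGroup X] [InnerProductSpace ℂ X]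
    (A : X → X → Prop) (U : ℝ → X ≃ₗᵢ[ℂ] X) : Prop where
  map_zero : ∀ f, U 0 f = f
  map_add : ∀ s t f, U (s + t) f = U s (U t f)
  continuous : ∀ f, Continuous fun t => U t f
  generator : ∀ f g, A f g ↔
    Tendsto (fun t : ℝ => (t : ℂ)⁻¹ • (U t f - f)) (𝓝[≠] 0) (𝓝 (Complex.I • g))

/-! The argument runs on the Fourier side. The Fourier transform is unitary on `L²`, and
`isLaplacian_iff` identifies the form Laplacian with multiplication by `-a`, where `a ξ =
(2π)²‖ξ‖²`. So the heat semigroup and the unitary group are the Fourier multipliers `e^{-ta}` and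
`e^{-ita}`, and dominated convergence shows that their generators are `A` and `iA` with exactly the
right domain.

The statements concern arbitrary families generated by `A` and `iA`. An energy estimate shows that a
solution of `u' = c A u` with `Re c ≥ 0` is determined by its initial value. Applied to `Q u`, where
the bounded operator `Q` preserves the graph of `A`, it says that `Q` commutes with both families
(the two `commute_of_commute` theorems). The choice `Q = id` gives uniqueness. The choice of
pointwise orthogonal projection onto a closed ideal `I`, which commutes with the Fourier transform,
gives the invariance of `L²(ℝ^N; I)`.

If a family is irreducible, every `L²(ℝ^N; I)` is therefore trivial, so `H` has only trivial closed
ideals. For `x` in the real part, the ideal of vectors disjoint from `x⁺` contains `x⁻`. It is zero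
or everything, so `x ≥ 0` or `x ≤ 0`. A totally ordered Hilbert lattice is one-dimensional, since a
positive vector orthogonal to a positive unit vector vanishes.

Conversely, if `H = ℂ`, closed ideals are solid for the pointwise norm. A nonzero one contains `φ e`
with `φ = min ‖f‖ gaussian`, nonnegative, integrable and not a.e. zero. At time one the heat
operator is, up to a nonzero factor, convolution with a strictly positive Gaussian, so it makes `φ
e` nonzero a.e.; truncation then yields all of `L²`. The unitary group has no such positivity, but
for `a ≥ 0` the number `e^{-a}` is an average of `e^{isa}` against the integrable Fourier transform
of `e^{-|x|}`. Closed subspaces invariant under the group are thus invariant under the heat operator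
at time one, and the previous case applies. -/

/-- Limits in `L²` of functions converging pointwise a.e. agree with the pointwise limit. -/
theorem ae_eq_of_tendsto_Lp {α H ι : Type*} [MeasurableSpace α] {μ : Measure α}
    [NormedAddCommGroup H] {l : Filter ι} [l.IsCountablyGenerated] [l.NeBot]
    {F : ι → Lp H 2 μ} {G : Lp H 2 μ} {φ : ι → α → H} {ψ : α → H}
    (hF : ∀ i, F i =ᵐ[μ] φ i) (hlim : ∀ᵐ x ∂μ, Tendsto (fun i => φ i x) l (𝓝 (ψ x)))
    (h : Tendsto F l (𝓝 G)) : G =ᵐ[μ] ψ := by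
  obtain ⟨u, hu⟩ := exists_seq_tendsto l
  obtain ⟨n, hn, hG⟩ := (tendstoInMeasure_of_tendsto_Lp (h.comp hu)).exists_seq_tendsto_ae
  have hall : ∀ᵐ x ∂μ, ∀ k, F (u k) x = φ (u k) x := ae_all_iff.2 fun k => hF (u k)
  filter_upwards [hG, hlim, hall] with x h1 h2 h3
  have h4 := (h2.comp hu).comp hn.tendsto_atTop
  refine tendsto_nhds_unique h1 (h4.congr fun k => ?_)
  simp [h3]

/-- Provides a dominating function, uniform in time, for the difference quotients of a
multiplication semigroup. For `‖z‖ > 1` both `exp z` and `1` have norm at most one. -/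
theorem norm_exp_sub_one_le_of_re_nonpos {z : ℂ} (hz : z.re ≤ 0) :
    ‖Complex.exp z - 1‖ ≤ 2 * ‖z‖ := by
  by_cases h : ‖z‖ ≤ 1
  · exact Complex.norm_exp_sub_one_le h
  · have h1 : ‖Complex.exp z‖ ≤ 1 := by
      rw [Complex.norm_exp]; exact Real.exp_le_one_iff.2 hz
    calc ‖Complex.exp z - 1‖ ≤ ‖Complex.exp z‖ + ‖(1 : ℂ)‖ := norm_sub_le _ _
      _ ≤ 2 * ‖z‖ := by rw [norm_one]; linarith

/-- Time enters through a map `τ`, so that one statement serves one-sided limits over `ℝ≥0` and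
two-sided limits over `ℝ`. -/
theorem tendsto_exp_slope (b : ℂ) {ι : Type*} {l : Filter ι} {τ : ι → ℝ}
    (hτ : Tendsto τ l (𝓝[≠] 0)) :
    Tendsto (fun i => ((τ i : ℝ) : ℂ)⁻¹ * (Complex.exp (τ i * b) - 1)) l (𝓝 b) := by
  have h1 : HasDerivAt (fun t : ℝ => Complex.exp (t * b)) b 0 := by
    have := (((hasDerivAt_id (0 : ℝ)).ofReal_comp).mul_const b).cexp
    simpa using this
  have h2 := h1.tendsto_slope_zero.comp hτ
  simpa [Function.comp_def, Complex.real_smul] using h2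

/-! ### Multiplication semigroups on `L²`. -/

section Multiplication

variable {α H : Type*} [MeasurableSpace α] {μ : Measure α}
  [NormedAddCommGroup H] [InnerProductSpace ℂ H]

theorem memLp_smul_of_norm_le_one {m : α → ℂ} (hm : AEStronglyMeasurable m μ)
    (hb : ∀ᵐ x ∂μ, ‖m x‖ ≤ 1) (f : Lp H 2 μ) : MemLp (fun x => m x • f x) 2 μ := by
  refine (Lp.memLp f).of_le (hm.smul (Lp.aestronglyMeasurable f)) ?_
  filter_upwards [hb] with x hx
  rw [norm_smul]
  exact mul_le_of_le_one_left (norm_nonneg _) hx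

/-- Multiplication by a function of modulus at most one, as an operator on `L²`. -/
noncomputable def mulLp (m : α → ℂ) (hm : AEStronglyMeasurable m μ)
    (hb : ∀ᵐ x ∂μ, ‖m x‖ ≤ 1) : Lp H 2 μ →L[ℂ] Lp H 2 μ :=
  LinearMap.mkContinuous
    { toFun := fun f => (memLp_smul_of_norm_le_one hm hb f).toLp _
      map_add' := fun f g => by
        rw [← MemLp.toLp_add]
        refine MemLp.toLp_congr _ _ ?_
        filter_upwards [Lp.coeFn_add f g] with x hx
        change m x • (f + g : Lp H 2 μ) x = m x • f x + m x • g x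
        rw [hx, Pi.add_apply, smul_add]
      map_smul' := fun c f => by
        rw [RingHom.id_apply, ← MemLp.toLp_const_smul]
        refine MemLp.toLp_congr _ _ ?_
        filter_upwards [Lp.coeFn_smul c f] with x hx
        change m x • (c • f : Lp H 2 μ) x = c • m x • f x
        rw [hx, Pi.smul_apply, smul_comm c] } 1 fun f => by
    rw [one_mul]
    refine Lp.norm_le_norm_of_ae_le ?_
    filter_upwards [MemLp.coeFn_toLp (memLp_smul_of_norm_le_one hm hb f), hb] with x hx h1
    change ‖((memLp_smul_of_norm_le_one hm hb f).toLp _ : Lp H 2 μ) x‖ ≤ _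
    rw [hx, norm_smul]
    exact mul_le_of_le_one_left (norm_nonneg _) h1

theorem mulLp_coeFn {m : α → ℂ} (hm : AEStronglyMeasurable m μ)
    (hb : ∀ᵐ x ∂μ, ‖m x‖ ≤ 1) (f : Lp H 2 μ) :
    mulLp m hm hb f =ᵐ[μ] fun x => m x • f x :=
  MemLp.coeFn_toLp (memLp_smul_of_norm_le_one hm hb f)

theorem Lp_norm_sq_eq_integral (f : Lp H 2 μ) : ‖f‖ ^ 2 = ∫ x, ‖f x‖ ^ 2 ∂μ := by
  have h : (inner ℂ f f : ℂ) = ∫ x, ((‖f x‖ ^ 2 : ℝ) : ℂ) ∂μ := by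
    rw [L2.inner_def]
    refine integral_congr_ae (Eventually.of_forall fun x => ?_)
    simp [inner_self_eq_norm_sq_to_K]
  rw [integral_complex_ofReal, inner_self_eq_norm_sq_to_K] at h
  refine Complex.ofReal_injective ?_
  rw [← h]
  push_cast
  rfl

/-- Dominated convergence in `L²`. -/
theorem tendsto_Lp_of_dominated {ι : Type*} {l : Filter ι} [l.IsCountablyGenerated]
    {F : ι → Lp H 2 μ} {G : Lp H 2 μ} {φ : ι → α → H} (bound : α → ℝ) (hbound : MemLp bound 2 μ)
    (hF : ∀ᶠ i in l, F i =ᵐ[μ] φ i) (hle : ∀ᶠ i in l, ∀ᵐ x ∂μ, ‖φ i x‖ ≤ bound x)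
    (hlim : ∀ᵐ x ∂μ, Tendsto (fun i => φ i x) l (𝓝 (G x))) : Tendsto F l (𝓝 G) := by
  have key : Tendsto (fun i => ‖F i - G‖ ^ 2) l (𝓝 0) := by
    have h1 : ∀ᶠ i in l, ‖F i - G‖ ^ 2 = ∫ x, ‖φ i x - G x‖ ^ 2 ∂μ := by
      filter_upwards [hF] with i hi
      rw [Lp_norm_sq_eq_integral]
      refine integral_congr_ae ?_
      filter_upwards [hi, Lp.coeFn_sub (F i) G] with x h1 h2
      rw [h2, Pi.sub_apply, h1]
    rw [tendsto_congr' h1]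
    have h0 : (0 : ℝ) = ∫ x : α, (0 : ℝ) ∂μ := by simp
    rw [h0]
    refine tendsto_integral_filter_of_dominated_convergence
      (fun x => (bound x + ‖G x‖) ^ 2) ?_ ?_ ?_ ?_
    · filter_upwards [hF] with i hi
      have := (Lp.aestronglyMeasurable (F i)).congr hi
      exact (this.sub (Lp.aestronglyMeasurable G)).norm.pow 2
    · filter_upwards [hle] with i hi
      filter_upwards [hi] with x hx
      rw [Real.norm_of_nonneg (by positivity)]
      gcongr
      exact (norm_sub_le _ _).trans (add_le_add_left hx _)
    · exact (hbound.add (Lp.memLp G).norm).integrable_sq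
    · filter_upwards [hlim] with x hx
      have : Tendsto (fun i => ‖φ i x - G x‖ ^ 2) l (𝓝 (‖G x - G x‖ ^ 2)) :=
        ((hx.sub_const _).norm).pow 2
      simpa using this
  rw [tendsto_iff_norm_sub_tendsto_zero]
  have := key.sqrt
  simpa [Real.sqrt_sq (norm_nonneg _)] using this

/-- The generator of the multiplication semigroup `exp (t b)` is the multiplication by `b`. -/
theorem tendsto_exp_mul_slope_iff {ι : Type*} {l : Filter ι} [l.IsCountablyGenerated] [l.NeBot]
    {τ : ι → ℝ} (hτ : Tendsto τ l (𝓝[≠] 0)) {b : α → ℂ}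
    (hre : ∀ i x, (τ i * b x).re ≤ 0) {f g : Lp H 2 μ} {F : ι → Lp H 2 μ}
    (hF : ∀ i, F i =ᵐ[μ] fun x => Complex.exp (τ i * b x) • f x) :
    Tendsto (fun i => ((τ i : ℝ) : ℂ)⁻¹ • (F i - f)) l (𝓝 g) ↔ g =ᵐ[μ] fun x => b x • f x := by
  have hφ : ∀ i, (((τ i : ℝ) : ℂ)⁻¹ • (F i - f) : Lp H 2 μ) =ᵐ[μ]
      fun x => (((τ i : ℝ) : ℂ)⁻¹ * (Complex.exp (τ i * b x) - 1)) • f x := by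
    intro i
    filter_upwards [hF i, Lp.coeFn_sub (F i) f, Lp.coeFn_smul ((τ i : ℝ) : ℂ)⁻¹ (F i - f)]
      with x h1 h2 h3
    rw [h3, Pi.smul_apply, h2, Pi.sub_apply, h1, mul_smul, sub_smul, one_smul]
  have hlim : ∀ x, Tendsto (fun i => (((τ i : ℝ) : ℂ)⁻¹ * (Complex.exp (τ i * b x) - 1)) • f x) l
      (𝓝 (b x • f x)) := fun x => (tendsto_exp_slope (b x) hτ).smul_const _
  constructor
  · intro h
    exact ae_eq_of_tendsto_Lp hφ (Eventually.of_forall hlim) h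
  · intro h
    -- The quotients are bounded by `2‖b x‖‖f x‖`, which is `2‖g x‖`; this is square integrable
    -- precisely because `f` lies in the domain.
    refine tendsto_Lp_of_dominated (fun x => 2 * ‖g x‖) ((Lp.memLp g).norm.const_mul 2)
      (Eventually.of_forall hφ) (Eventually.of_forall fun i => ?_) ?_
    · filter_upwards [h] with x hx
      rw [hx, norm_smul, norm_smul, ← mul_assoc]
      gcongr
      rw [norm_mul, norm_inv]
      have h1 := norm_exp_sub_one_le_of_re_nonpos (hre i x)
      rw [norm_mul] at h1
      by_cases h0 : τ i = 0
      · simp [h0]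
      · rw [inv_mul_le_iff₀ (by simpa using h0)]
        linarith
    · filter_upwards [h] with x hx
      rw [hx]
      exact hlim x

/-- Strong continuity of multiplication semigroups. -/
theorem continuous_exp_mul {ι : Type*} [TopologicalSpace ι] [FirstCountableTopology ι]
    {τ : ι → ℝ} (hτ : Continuous τ) {b : α → ℂ}
    (hre : ∀ i x, (τ i * b x).re ≤ 0) {f : Lp H 2 μ} {F : ι → Lp H 2 μ}
    (hF : ∀ i, F i =ᵐ[μ] fun x => Complex.exp (τ i * b x) • f x) : Continuous F := by
  rw [continuous_iff_continuousAt]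
  intro i
  refine tendsto_Lp_of_dominated (fun x => ‖f x‖) (Lp.memLp f).norm
    (Eventually.of_forall hF) (Eventually.of_forall fun j => Eventually.of_forall fun x => ?_) ?_
  · rw [norm_smul, Complex.norm_exp]
    exact mul_le_of_le_one_left (norm_nonneg _) (Real.exp_le_one_iff.2 (hre j x))
  · filter_upwards [hF i] with x hx
    rw [hx]
    have : Continuous fun j => Complex.exp (τ j * b x) • f x := by fun_prop
    exact this.tendsto i

end Multiplication

/-! ### Distributional derivatives on the Fourier side. -/

section FourierLaplacian

open FourierTransform TemperedDistribution

variable {V H : Type*} [NormedAddCommGroup V] [InnerProductSpace ℝ V] [FiniteDimensional ℝ V]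
  [MeasurableSpace V] [BorelSpace V]
  [NormedAddCommGroup H] [InnerProductSpace ℂ H] [CompleteSpace H]

theorem Lp_toTemperedDistribution_injective :
    Function.Injective (fun f : Lp H 2 (volume : Measure V) => (f : 𝓢'(V, H))) :=
  LinearMap.ker_eq_bot.1
    (Lp.ker_toTemperedDistributionCLM_eq_bot (F := H) (μ := (volume : Measure V)) (p := 2))

/-- Both sides are locally integrable functions, and these are separated by smooth compactly
supported test functions. This turns an identity of distributions into a pointwise one. -/
theorem smulLeftCLM_toTemperedDistribution_eq_iff {g : V → ℂ} (hg : g.HasTemperateGrowth)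
    (f k : Lp H 2 (volume : Measure V)) :
    smulLeftCLM H g (f : 𝓢'(V, H)) = (k : 𝓢'(V, H)) ↔ k =ᵐ[volume] fun x => g x • f x := by
  have hsmul : ∀ u : 𝓢(V, ℂ), smulLeftCLM H g (f : 𝓢'(V, H)) u = ∫ x, u x • g x • f x := by
    intro u
    simp only [smulLeftCLM_apply_apply, Lp.toTemperedDistribution_apply]
    refine integral_congr_ae (Eventually.of_forall fun x => ?_)
    simp [hg, smul_smul, mul_comm]
  constructor
  · intro h
    have hk : LocallyIntegrable (fun x => k x) (volume : Measure V) :=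
      (Lp.memLp k).locallyIntegrable (by norm_num)
    have hf : LocallyIntegrable (fun x => g x • f x) (volume : Measure V) := by
      have h1 : LocallyIntegrable (fun x => f x) (volume : Measure V) :=
        (Lp.memLp f).locallyIntegrable (by norm_num)
      exact h1.continuous_smul hg.1.continuous
    refine ae_eq_of_integral_contDiff_smul_eq hk hf fun φ hφ hφc => ?_
    have hc : HasCompactSupport (Complex.ofRealCLM ∘ φ) := hφc.comp_left rfl
    have hd : ContDiff ℝ (⊤ : ℕ∞) (Complex.ofRealCLM ∘ φ) := by fun_prop
    have h2 := congrArg (fun T : 𝓢'(V, H) => T (hc.toSchwartzMap hd)) h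
    simp only [hsmul, Lp.toTemperedDistribution_apply] at h2
    simpa using h2.symm
  · intro h
    ext u
    rw [hsmul, Lp.toTemperedDistribution_apply]
    refine integral_congr_ae ?_
    filter_upwards [h] with x hx
    rw [hx]

theorem lineDerivOp_toTemperedDistribution_eq_iff (m : V) (f k : Lp H 2 (volume : Measure V)) :
    ∂_{m} (f : 𝓢'(V, H)) = (k : 𝓢'(V, H)) ↔
      (𝓕 k : Lp H 2 (volume : Measure V)) =ᵐ[volume]
        fun ξ => (2 * Real.pi * Complex.I * (inner ℝ ξ m : ℝ)) • (𝓕 f) ξ := by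
  have hg : (fun ξ : V => ((inner ℝ ξ m : ℝ) : ℂ)).HasTemperateGrowth := by fun_prop
  have hg2 : ((2 * Real.pi * Complex.I) •
    fun ξ : V => ((inner ℝ ξ m : ℝ) : ℂ)).HasTemperateGrowth := by fun_prop
  have hinj : Function.Injective (fun T : 𝓢'(V, H) => 𝓕 T) :=
    Function.LeftInverse.injective (g := fun T => 𝓕⁻ T)
      fun T => FourierTransform.fourierInv_fourier_eq T
  rw [← hinj.eq_iff]
  change 𝓕 (∂_{m} (f : 𝓢'(V, H))) = 𝓕 (k : 𝓢'(V, H)) ↔ _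
  rw [fourier_lineDerivOp_eq, Lp.fourier_toTemperedDistribution_eq,
    Lp.fourier_toTemperedDistribution_eq, ← _root_.smul_apply, ← smulLeftCLM_smul hg,
    smulLeftCLM_toTemperedDistribution_eq_iff hg2]
  rfl

end FourierLaplacian

/-! ### The form Laplacian as a multiplication operator. -/

section LaplacianSymbol

open FourierTransform

variable {N : ℕ} {H : Type*} [NormedAddCommGroup H] [InnerProductSpace ℂ H] [CompleteSpace H]

theorem hasWeakGradient_iff {f : BochnerL2 N H} {F : Fin N → BochnerL2 N H} :
    HasWeakGradient f F ↔ ∀ j, (𝓕 (F j) : BochnerL2 N H) =ᵐ[volume]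
      fun ξ => (2 * Real.pi * Complex.I * (ξ j : ℝ)) • (𝓕 f) ξ := by
  refine forall_congr' fun j => ?_
  rw [lineDerivOp_toTemperedDistribution_eq_iff]
  simp [EuclideanSpace.inner_single_right]

/-- The Fourier symbol of the Laplace operator. -/
noncomputable def laplaceSymbol {N : ℕ} (ξ : EuclideanSpace ℝ (Fin N)) : ℝ :=
  (2 * Real.pi) ^ 2 * ‖ξ‖ ^ 2

theorem laplaceSymbol_nonneg (ξ : EuclideanSpace ℝ (Fin N)) : 0 ≤ laplaceSymbol ξ := by
  unfold laplaceSymbol; positivity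

theorem continuous_laplaceSymbol : Continuous (laplaceSymbol (N := N)) := by
  unfold laplaceSymbol; fun_prop

theorem sum_symbol_inner {N : ℕ} {H : Type*} [NormedAddCommGroup H] [InnerProductSpace ℂ H]
    (ξ : EuclideanSpace ℝ (Fin N)) (v w : H) :
    ∑ j, inner ℂ ((2 * Real.pi * Complex.I * (ξ j : ℝ)) • v)
      ((2 * Real.pi * Complex.I * (ξ j : ℝ)) • w) = (laplaceSymbol ξ : ℂ) * inner ℂ v w := by
  have h : ∀ j, inner ℂ ((2 * Real.pi * Complex.I * (ξ j : ℝ)) • v)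
      ((2 * Real.pi * Complex.I * (ξ j : ℝ)) • w) =
      (((2 * Real.pi) ^ 2 * (ξ j) ^ 2 : ℝ) : ℂ) * inner ℂ v w := by
    intro j
    rw [inner_smul_left, inner_smul_right]
    simp only [map_mul, Complex.conj_I, Complex.conj_ofReal, map_ofNat]
    push_cast
    linear_combination (-(2 * Real.pi) ^ 2 * (ξ j : ℂ) ^ 2 * inner ℂ v w) * Complex.I_mul_I
  simp_rw [h]
  rw [← Finset.sum_mul, ← Complex.ofReal_sum, ← Finset.mul_sum, laplaceSymbol,
    EuclideanSpace.real_norm_sq_eq]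

/-- Plancherel in each coordinate, followed by summing `|2πi ξ_j|²` to the symbol. -/
theorem sum_inner_weakGradient {f v : BochnerL2 N H} {F V : Fin N → BochnerL2 N H}
    (hf : HasWeakGradient f F) (hv : HasWeakGradient v V) :
    ∑ j, inner ℂ (V j) (F j) = ∫ ξ, (laplaceSymbol ξ : ℂ) * inner ℂ ((𝓕 v) ξ) ((𝓕 f) ξ) := by
  rw [hasWeakGradient_iff] at hf hv
  have h1 : ∀ j, inner ℂ (V j) (F j) = ∫ ξ, inner ℂ ((𝓕 (V j)) ξ) ((𝓕 (F j)) ξ) := by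
    intro j
    rw [← Lp.inner_fourier_eq, L2.inner_def]
  simp_rw [h1]
  rw [← integral_finsetSum _ fun j _ => L2.integrable_inner (𝕜 := ℂ) (𝓕 (V j)) (𝓕 (F j))]
  refine integral_congr_ae ?_
  filter_upwards [ae_all_iff.2 hf, ae_all_iff.2 hv] with ξ h2 h3
  simp_rw [h2, h3]
  exact sum_symbol_inner ξ _ _

theorem exists_Lp_fourier_eq {w : EuclideanSpace ℝ (Fin N) → H} (hw : MemLp w 2 volume) :
    ∃ v : BochnerL2 N H, (𝓕 v : BochnerL2 N H) =ᵐ[volume] w :=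
  ⟨𝓕⁻ (hw.toLp w), by rw [FourierTransform.fourier_fourierInv_eq]; exact hw.coeFn_toLp⟩

/-- Each `|ξ_j|` is at most `‖ξ‖`, so every coordinate multiplier maps `𝓕 f` into `L²`. -/
theorem exists_hasWeakGradient {f : BochnerL2 N H}
    (h : MemLp (fun ξ => (‖ξ‖ : ℂ) • (𝓕 f) ξ) 2 volume) : ∃ F, HasWeakGradient f F := by
  have h1 : ∀ j : Fin N, ∃ v : BochnerL2 N H, (𝓕 v : BochnerL2 N H) =ᵐ[volume]
      fun ξ => (2 * Real.pi * Complex.I * (ξ j : ℝ)) • (𝓕 f) ξ := by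
    intro j
    refine exists_Lp_fourier_eq (h.of_le_mul (c := 2 * Real.pi) ?_ (Eventually.of_forall ?_))
    · refine AEStronglyMeasurable.smul (Continuous.aestronglyMeasurable ?_)
        (Lp.aestronglyMeasurable _)
      fun_prop
    · intro ξ
      rw [norm_smul, norm_smul, ← mul_assoc]
      gcongr
      have h2 : ‖((ξ j : ℝ) : ℂ)‖ ≤ ‖(‖ξ‖ : ℂ)‖ := by
        simpa using PiLp.norm_apply_le ξ j
      have h3 : ‖(2 * Real.pi * Complex.I : ℂ)‖ = 2 * Real.pi := by
        simp [abs_of_pos Real.pi_pos]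
      rw [norm_mul, h3]
      gcongr
  choose F hF using h1
  exact ⟨F, hasWeakGradient_iff.2 hF⟩

/-- The Laplace operator acts on the Fourier side as multiplication by its symbol. -/
theorem isLaplacian_iff {f g : BochnerL2 N H} :
    IsLaplacian f g ↔
      (𝓕 g : BochnerL2 N H) =ᵐ[volume] fun ξ => (-(laplaceSymbol ξ : ℂ)) • (𝓕 f) ξ := by
  constructor
  · rintro ⟨F, hF, h⟩
    have hsym : Continuous fun ξ : EuclideanSpace ℝ (Fin N) => (laplaceSymbol ξ : ℂ) :=
      Complex.continuous_ofReal.comp continuous_laplaceSymbol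
    -- The goal is `w = 0`, but `w` is not known to be in `L²`. It is cut off to balls, and the
    -- function whose Fourier transform is the cut-off is used as a test function: bounded frequency
    -- support puts it in `H¹`, and the form identity becomes `∫_B ‖w‖² = 0`.
    set w : EuclideanSpace ℝ (Fin N) → H := fun ξ => (𝓕 g) ξ + (laplaceSymbol ξ : ℂ) • (𝓕 f) ξ
      with hw
    have hwm : AEStronglyMeasurable w volume :=
      (Lp.aestronglyMeasurable _).add
        (hsym.aestronglyMeasurable.smul (Lp.aestronglyMeasurable _))
    have key : ∀ n : ℕ, ∀ᵐ ξ, ξ ∈ Metric.closedBall (0 : EuclideanSpace ℝ (Fin N)) n → w ξ = 0 := by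
      intro n
      set B := Metric.closedBall (0 : EuclideanSpace ℝ (Fin N)) (n : ℝ) with hB
      have hBm : MeasurableSet B := Metric.isClosed_closedBall.measurableSet
      have hbd : ∀ ξ ∈ B, ‖ξ‖ ≤ n := fun ξ hξ => by simpa [hB] using hξ
      have hmem : MemLp (B.indicator w) 2 volume := by
        refine MemLp.of_le_mul (c := 1)
          (g := fun ξ => ‖(𝓕 g) ξ‖ + (2 * Real.pi) ^ 2 * n ^ 2 * ‖(𝓕 f) ξ‖)
          ((Lp.memLp _).norm.add ((Lp.memLp _).norm.const_mul _)) (hwm.indicator hBm)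
          (Eventually.of_forall fun ξ => ?_)
        rw [one_mul]
        by_cases hξ : ξ ∈ B
        · rw [Set.indicator_of_mem hξ, Real.norm_of_nonneg (by positivity)]
          refine (norm_add_le _ _).trans (add_le_add le_rfl ?_)
          rw [norm_smul, Complex.norm_real, Real.norm_of_nonneg (laplaceSymbol_nonneg ξ),
            laplaceSymbol]
          have := hbd ξ hξ
          gcongr
        · rw [Set.indicator_of_notMem hξ]
          simp
      obtain ⟨v, hv⟩ := exists_Lp_fourier_eq hmem
      obtain ⟨V, hV⟩ : ∃ V, HasWeakGradient v V := by
        refine exists_hasWeakGradient ?_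
        refine hmem.of_le_mul (c := n) ((Continuous.aestronglyMeasurable (by fun_prop)).smul
          (Lp.aestronglyMeasurable _)) ?_
        filter_upwards [hv] with ξ hξ
        rw [hξ, norm_smul]
        by_cases hξB : ξ ∈ B
        · gcongr
          simpa using hbd ξ hξB
        · simp [Set.indicator_of_notMem hξB]
      have h1 := h v V hV
      rw [sum_inner_weakGradient hF hV, ← Lp.inner_fourier_eq v g, L2.inner_def] at h1
      have hi1 : Integrable fun ξ => (laplaceSymbol ξ : ℂ) * inner ℂ ((𝓕 v) ξ) ((𝓕 f) ξ) := by
        refine ((L2.integrable_inner (𝕜 := ℂ) (𝓕 v) (𝓕 f)).norm.const_mul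
          ((2 * Real.pi) ^ 2 * n ^ 2)).mono' (hsym.aestronglyMeasurable.mul
          (L2.integrable_inner (𝕜 := ℂ) (𝓕 v) (𝓕 f)).1) ?_
        filter_upwards [hv] with ξ hξ
        rw [hξ]
        by_cases hξB : ξ ∈ B
        · rw [norm_mul, Complex.norm_real, Real.norm_of_nonneg (laplaceSymbol_nonneg ξ),
            laplaceSymbol]
          have := hbd ξ hξB
          gcongr
        · simp [Set.indicator_of_notMem hξB]
      rw [eq_neg_iff_add_eq_zero,
        ← integral_add hi1 (L2.integrable_inner (𝕜 := ℂ) (𝓕 v) (𝓕 g))] at h1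
      have h2 : ∫ ξ, ((‖B.indicator w ξ‖ ^ 2 : ℝ) : ℂ) = 0 := by
        rw [← h1]
        refine integral_congr_ae ?_
        filter_upwards [hv] with ξ hξ
        rw [hξ]
        by_cases hξB : ξ ∈ B
        · rw [Set.indicator_of_mem hξB, ← inner_smul_right, ← inner_add_right, add_comm]
          change _ = inner ℂ (w ξ) (w ξ)
          rw [inner_self_eq_norm_sq_to_K]
          push_cast
          rfl
        · simp [Set.indicator_of_notMem hξB]
      rw [integral_complex_ofReal, Complex.ofReal_eq_zero,
        integral_eq_zero_iff_of_nonneg (fun ξ => by positivity)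
          ((memLp_two_iff_integrable_sq_norm hmem.1).1 hmem)] at h2
      filter_upwards [h2] with ξ hξ hξB
      simpa [Set.indicator_of_mem hξB] using hξ
    filter_upwards [ae_all_iff.2 key] with ξ hξ
    obtain ⟨n, hn⟩ := exists_nat_ge ‖ξ‖
    have := hξ n (by simpa using hn)
    rw [neg_smul]
    exact eq_neg_of_add_eq_zero_left this
  · intro h
    obtain ⟨F, hF⟩ : ∃ F, HasWeakGradient f F := by
      refine exists_hasWeakGradient (MemLp.of_le_mul (c := 1)
        (g := fun ξ => ‖(𝓕 f) ξ‖ + ‖(𝓕 g) ξ‖) ((Lp.memLp _).norm.add (Lp.memLp _).norm)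
        ((Continuous.aestronglyMeasurable (by fun_prop)).smul (Lp.aestronglyMeasurable _)) ?_)
      filter_upwards [h] with ξ hξ
      rw [hξ, norm_smul, norm_smul, one_mul, Real.norm_of_nonneg (by positivity), norm_neg,
        Complex.norm_real, Complex.norm_real, Real.norm_of_nonneg (laplaceSymbol_nonneg ξ),
        norm_norm, ← one_add_mul]
      gcongr
      -- The remaining claim is `‖ξ‖ ≤ 1 + a ξ`, which follows from `‖ξ‖ ≤ 1 + ‖ξ‖²`.
      have h1 : (1 : ℝ) ≤ (2 * Real.pi) ^ 2 := by nlinarith [Real.pi_gt_three]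
      unfold laplaceSymbol
      nlinarith [sq_nonneg (‖ξ‖ - 1), sq_nonneg ‖ξ‖]
    refine ⟨F, hF, fun v V hV => ?_⟩
    rw [sum_inner_weakGradient hF hV, ← Lp.inner_fourier_eq v g, L2.inner_def, ← integral_neg]
    refine integral_congr_ae ?_
    filter_upwards [h] with ξ hξ
    rw [hξ, inner_smul_right, neg_mul, neg_neg]

end LaplacianSymbol

section Isometry

variable {X : Type*} [NormedAddCommGroup X] [NormedSpace ℂ X]

/-- A norm preserving operator with a right inverse is an isometric isomorphism. -/
noncomputable def isometryEquivOfInverse (S : X →L[ℂ] X) (hS : ∀ f, ‖S f‖ = ‖f‖) (T : X → X)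
    (h : ∀ f, S (T f) = f) : X ≃ₗᵢ[ℂ] X :=
  LinearIsometryEquiv.ofSurjective ⟨(S : X →ₗ[ℂ] X), hS⟩ fun f => ⟨T f, h f⟩

theorem isometryEquivOfInverse_apply (S : X →L[ℂ] X) (hS : ∀ f, ‖S f‖ = ‖f‖) (T : X → X)
    (h : ∀ f, S (T f) = f) (f : X) : isometryEquivOfInverse S hS T h f = S f := rfl

end Isometry

/-! ### Existence of the heat semigroup and of the unitary group. -/

section FourierMultiplier

open FourierTransform

variable {N : ℕ} {H : Type*} [NormedAddCommGroup H] [InnerProductSpace ℂ H] [CompleteSpace H]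

/-- The Fourier multiplier operator with a symbol of modulus at most one. -/
noncomputable def fourierMulLp (m : EuclideanSpace ℝ (Fin N) → ℂ)
    (hm : AEStronglyMeasurable m volume) (hb : ∀ᵐ x, ‖m x‖ ≤ 1) :
    BochnerL2 N H →L[ℂ] BochnerL2 N H :=
  ((Lp.fourierTransformₗᵢ (EuclideanSpace ℝ (Fin N)) H).symm.toContinuousLinearEquiv :
      BochnerL2 N H →L[ℂ] BochnerL2 N H) ∘L mulLp m hm hb ∘L
    ((Lp.fourierTransformₗᵢ (EuclideanSpace ℝ (Fin N)) H).toContinuousLinearEquiv :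
      BochnerL2 N H →L[ℂ] BochnerL2 N H)

theorem fourier_fourierMulLp {m : EuclideanSpace ℝ (Fin N) → ℂ}
    (hm : AEStronglyMeasurable m volume) (hb : ∀ᵐ x, ‖m x‖ ≤ 1) (f : BochnerL2 N H) :
    (𝓕 (fourierMulLp m hm hb f) : BochnerL2 N H) =ᵐ[volume] fun ξ => m ξ • (𝓕 f) ξ := by
  have : (𝓕 (fourierMulLp m hm hb f) : BochnerL2 N H) = mulLp m hm hb (𝓕 f) :=
    (Lp.fourierTransformₗᵢ (EuclideanSpace ℝ (Fin N)) H).apply_symm_apply _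
  rw [this]
  exact mulLp_coeFn hm hb _

theorem Lp_ext_fourier {f g : BochnerL2 N H}
    (h : (𝓕 f : BochnerL2 N H) =ᵐ[volume] (𝓕 g : BochnerL2 N H)) : f = g :=
  (Lp.fourierTransformₗᵢ (EuclideanSpace ℝ (Fin N)) H).injective (Lp.ext h)

theorem tendsto_fourier_iff {ι : Type*} {l : Filter ι} {F : ι → BochnerL2 N H}
    {G : BochnerL2 N H} :
    Tendsto (fun i => (𝓕 (F i) : BochnerL2 N H)) l (𝓝 (𝓕 G)) ↔ Tendsto F l (𝓝 G) :=
  ((Lp.fourierTransformₗᵢ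
    (EuclideanSpace ℝ (Fin N)) H).isometry.isEmbedding.isInducing.tendsto_nhds_iff).symm

theorem norm_cexp_le_one {z : ℂ} (hz : z.re ≤ 0) : ‖Complex.exp z‖ ≤ 1 := by
  rw [Complex.norm_exp]
  exact Real.exp_le_one_iff.2 hz

theorem aestronglyMeasurable_cexp_symbol (c : ℂ) :
    AEStronglyMeasurable (fun ξ : EuclideanSpace ℝ (Fin N) => Complex.exp (c * laplaceSymbol ξ))
      volume := by
  have := continuous_laplaceSymbol (N := N)
  exact Continuous.aestronglyMeasurable (by fun_prop)

/-- The operator `exp (-c A)`, for `Re c ≤ 0`, where `A` is the Laplace operator. -/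
noncomputable def expLaplace (c : ℂ) (hc : c.re ≤ 0) : BochnerL2 N H →L[ℂ] BochnerL2 N H :=
  fourierMulLp (fun ξ => Complex.exp (c * laplaceSymbol ξ)) (aestronglyMeasurable_cexp_symbol c)
    (Eventually.of_forall fun ξ => norm_cexp_le_one (by
      rw [Complex.re_mul_ofReal]
      exact mul_nonpos_of_nonpos_of_nonneg hc (laplaceSymbol_nonneg ξ)))

theorem fourier_expLaplace (c : ℂ) (hc : c.re ≤ 0) (f : BochnerL2 N H) :
    (𝓕 (expLaplace c hc f) : BochnerL2 N H) =ᵐ[volume]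
      fun ξ => Complex.exp (c * laplaceSymbol ξ) • (𝓕 f) ξ :=
  fourier_fourierMulLp _ _ f

theorem expLaplace_zero (h0 : (0 : ℂ).re ≤ 0) (f : BochnerL2 N H) : expLaplace 0 h0 f = f := by
  refine Lp_ext_fourier ?_
  filter_upwards [fourier_expLaplace 0 h0 f] with ξ hξ
  rw [hξ]
  simp

theorem expLaplace_add {c d : ℂ} (hc : c.re ≤ 0) (hd : d.re ≤ 0) (h : (c + d).re ≤ 0)
    (f : BochnerL2 N H) : expLaplace (c + d) h f = expLaplace c hc (expLaplace d hd f) := by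
  refine Lp_ext_fourier ?_
  filter_upwards [fourier_expLaplace (c + d) h f, fourier_expLaplace d hd f,
    fourier_expLaplace c hc (expLaplace d hd f)] with ξ h1 h2 h3
  rw [h1, h3, h2, smul_smul, ← Complex.exp_add, add_mul]

theorem continuous_expLaplace {ι : Type*} [TopologicalSpace ι] [FirstCountableTopology ι]
    {τ : ι → ℝ} (hτ : Continuous τ) {b : ℂ} (hre : ∀ i, (τ i * b).re ≤ 0) (f : BochnerL2 N H) :
    Continuous fun i => expLaplace (τ i * b) (hre i) f := by
  have h1 : Continuous fun i => (𝓕 (expLaplace (τ i * b) (hre i) f) : BochnerL2 N H) := by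
    refine continuous_exp_mul hτ (b := fun ξ => b * laplaceSymbol ξ) (f := 𝓕 f) ?_ fun i => ?_
    · intro i ξ
      rw [← mul_assoc, Complex.re_mul_ofReal]
      exact mul_nonpos_of_nonpos_of_nonneg (hre i) (laplaceSymbol_nonneg ξ)
    · filter_upwards [fourier_expLaplace (τ i * b) (hre i) f] with ξ hξ
      rw [hξ, mul_assoc]
  rw [continuous_iff_continuousAt] at h1 ⊢
  exact fun i => tendsto_fourier_iff.1 (h1 i)

/-- The case `b = -1` identifies the heat generator and `b = -i` the generator of the unitary group;
the equivalence captures the whole domain. -/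
theorem tendsto_expLaplace_slope_iff {ι : Type*} {l : Filter ι} [l.IsCountablyGenerated] [l.NeBot]
    {τ : ι → ℝ} (hτ : Tendsto τ l (𝓝[≠] 0)) {b : ℂ} (hre : ∀ i, (τ i * b).re ≤ 0)
    {f g : BochnerL2 N H} :
    Tendsto (fun i => ((τ i : ℝ) : ℂ)⁻¹ • (expLaplace (τ i * b) (hre i) f - f)) l (𝓝 g) ↔
      (𝓕 g : BochnerL2 N H) =ᵐ[volume] fun ξ => (b * laplaceSymbol ξ) • (𝓕 f) ξ := by
  rw [← tendsto_exp_mul_slope_iff hτ (b := fun ξ => b * laplaceSymbol ξ)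
    (F := fun i => 𝓕 (expLaplace (τ i * b) (hre i) f)), ← tendsto_fourier_iff]
  · refine iff_of_eq (congrArg (fun u => Tendsto u l _) (funext fun i => ?_))
    exact ((Lp.fourierTransformₗᵢ (EuclideanSpace ℝ (Fin N)) H).map_smul _ _).trans
      (congrArg _ ((Lp.fourierTransformₗᵢ (EuclideanSpace ℝ (Fin N)) H).map_sub _ _))
  · intro i ξ
    rw [← mul_assoc, Complex.re_mul_ofReal]
    exact mul_nonpos_of_nonpos_of_nonneg (hre i) (laplaceSymbol_nonneg ξ)
  · intro i
    filter_upwards [fourier_expLaplace (τ i * b) (hre i) f] with ξ hξ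
    rw [hξ, mul_assoc]

theorem heat_re_nonpos (t : ℝ≥0) : (((t : ℝ) : ℂ) * (-1)).re ≤ 0 := by simp

theorem schrodinger_re_nonpos (t : ℝ) : ((t : ℂ) * (-Complex.I)).re ≤ 0 := by simp

/-- The heat semigroup. -/
noncomputable def heatOp (t : ℝ≥0) : BochnerL2 N H →L[ℂ] BochnerL2 N H :=
  expLaplace (((t : ℝ) : ℂ) * (-1)) (heat_re_nonpos t)

theorem heatOp_isSemigroupGeneratedBy :
    IsSemigroupGeneratedBy IsLaplacian (heatOp (N := N) (H := H)) where
  map_zero f := by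
    have : (((0 : ℝ≥0) : ℝ) : ℂ) * (-1) = 0 := by simp
    simp only [heatOp, this]
    exact expLaplace_zero _ f
  map_add s t f := by
    have : (((s + t : ℝ≥0) : ℝ) : ℂ) * (-1) = ((s : ℝ) : ℂ) * (-1) + ((t : ℝ) : ℂ) * (-1) := by
      push_cast; ring
    simp only [heatOp, this]
    exact expLaplace_add _ _ _ f
  continuous f := continuous_expLaplace NNReal.continuous_coe heat_re_nonpos f
  generator f g := by
    have hτ : Tendsto (fun t : ℝ≥0 => (t : ℝ)) (𝓝[>] 0) (𝓝[≠] 0) := by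
      refine tendsto_nhdsWithin_iff.2 ⟨?_, ?_⟩
      · exact (NNReal.continuous_coe.tendsto' 0 0 rfl).mono_left nhdsWithin_le_nhds
      · filter_upwards [self_mem_nhdsWithin] with t ht
        exact NNReal.coe_ne_zero.2 (ne_of_gt ht)
    rw [isLaplacian_iff]
    simp only [heatOp]
    rw [tendsto_expLaplace_slope_iff hτ heat_re_nonpos]
    simp only [neg_one_mul]

/-- The operators of the unitary group, as bounded operators. -/
noncomputable def schrodingerCLM (t : ℝ) : BochnerL2 N H →L[ℂ] BochnerL2 N H :=
  expLaplace ((t : ℂ) * (-Complex.I)) (schrodinger_re_nonpos t)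

theorem schrodingerCLM_zero (f : BochnerL2 N H) : schrodingerCLM 0 f = f := by
  have : ((0 : ℝ) : ℂ) * (-Complex.I) = 0 := by simp
  simp only [schrodingerCLM, this]
  exact expLaplace_zero _ f

theorem schrodingerCLM_add (s t : ℝ) (f : BochnerL2 N H) :
    schrodingerCLM (s + t) f = schrodingerCLM s (schrodingerCLM t f) := by
  have : ((s + t : ℝ) : ℂ) * (-Complex.I) = (s : ℂ) * (-Complex.I) + (t : ℂ) * (-Complex.I) := by
    push_cast; ring
  simp only [schrodingerCLM, this]
  exact expLaplace_add _ _ _ f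

theorem norm_schrodingerCLM (t : ℝ) (f : BochnerL2 N H) : ‖schrodingerCLM t f‖ = ‖f‖ := by
  rw [← Lp.norm_fourier_eq, ← Lp.norm_fourier_eq f]
  refine le_antisymm (Lp.norm_le_norm_of_ae_le ?_) (Lp.norm_le_norm_of_ae_le ?_) <;>
  · filter_upwards [fourier_expLaplace _ (schrodinger_re_nonpos t) f] with ξ hξ
    simp only [schrodingerCLM]
    rw [hξ, norm_smul, Complex.norm_exp]
    simp

/-- The unitary group generated by `i` times the Laplace operator. -/
noncomputable def schrodingerOp (t : ℝ) : BochnerL2 N H ≃ₗᵢ[ℂ] BochnerL2 N H :=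
  isometryEquivOfInverse (schrodingerCLM t) (norm_schrodingerCLM t) (schrodingerCLM (-t))
    fun f => by rw [← schrodingerCLM_add, add_neg_cancel, schrodingerCLM_zero]

theorem schrodingerOp_apply (t : ℝ) (f : BochnerL2 N H) :
    schrodingerOp t f = schrodingerCLM t f :=
  isometryEquivOfInverse_apply _ _ _ _ f

theorem schrodingerOp_isUnitaryGroupGeneratedBy :
    IsUnitaryGroupGeneratedBy IsLaplacian (schrodingerOp (N := N) (H := H)) where
  map_zero f := by rw [schrodingerOp_apply, schrodingerCLM_zero]
  map_add s t f := by simp only [schrodingerOp_apply, schrodingerCLM_add]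
  continuous f := by
    simp only [schrodingerOp_apply, schrodingerCLM]
    exact continuous_expLaplace continuous_id schrodinger_re_nonpos f
  generator f g := by
    simp only [schrodingerOp_apply, schrodingerCLM]
    rw [isLaplacian_iff]
    refine Iff.trans ?_
      (tendsto_expLaplace_slope_iff (τ := fun t => t) tendsto_id schrodinger_re_nonpos).symm
    have h1 : (𝓕 (Complex.I • g) : BochnerL2 N H) = Complex.I • 𝓕 g :=
      (Lp.fourierTransformₗᵢ (EuclideanSpace ℝ (Fin N)) H).map_smul _ _
    rw [h1]
    constructor
    · intro h
      filter_upwards [h, Lp.coeFn_smul Complex.I (𝓕 g)] with ξ h2 h3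
      rw [h3, Pi.smul_apply, h2, smul_smul, mul_neg, neg_mul]
    · intro h
      filter_upwards [h, Lp.coeFn_smul Complex.I (𝓕 g)] with ξ h2 h3
      rw [h3, Pi.smul_apply] at h2
      refine smul_right_injective H Complex.I_ne_zero ?_
      change Complex.I • _ = Complex.I • _
      rw [h2, smul_smul, mul_neg, neg_mul]

end FourierMultiplier

/-! ### Uniqueness and commutation for dissipative generators. -/

section Uniqueness

variable {X : Type*} [NormedAddCommGroup X] [InnerProductSpace ℂ X]

/-- A continuous curve starting at `0` whose right derivative is dissipative vanishes. -/
theorem eq_zero_of_dissipative {u u' : ℝ → X} (hu : ContinuousOn u (Set.Ici 0))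
    (hu' : ∀ t, 0 ≤ t → HasDerivWithinAt u (u' t) (Set.Ici t) t)
    (hd : ∀ t, 0 ≤ t → (inner ℂ (u t) (u' t)).re ≤ 0) (h0 : u 0 = 0) :
    ∀ t, 0 ≤ t → u t = 0 := by
  intro t ht
  have hsq : ∀ s, (inner ℂ (u s) (u s)).re = ‖u s‖ ^ 2 := fun s =>
    inner_self_eq_norm_sq (𝕜 := ℂ) (u s)
  have hder : ∀ s ∈ Set.Ico (0 : ℝ) t, HasDerivWithinAt (fun r => (inner ℂ (u r) (u r)).re)
      (2 * (inner ℂ (u s) (u' s)).re) (Set.Ici s) s := by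
    intro s hs
    have h1 := (hu' s hs.1).inner ℂ (hu' s hs.1)
    have h2 := (Complex.reCLM.hasFDerivAt.comp_hasDerivWithinAt s h1)
    refine h2.congr_deriv ?_
    change (inner ℂ (u s) (u' s) + inner ℂ (u' s) (u s)).re = _
    rw [← inner_conj_symm (u' s) (u s), Complex.add_re, Complex.conj_re, two_mul]
  have hc : ContinuousOn (fun r => (inner ℂ (u r) (u r)).re) (Set.Icc 0 t) := by
    have h1 : ContinuousOn u (Set.Icc 0 t) := hu.mono fun _ hx => hx.1
    exact Complex.continuous_re.comp_continuousOn (h1.inner h1)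
  -- The squared norm starts at zero and has nonpositive right derivative, so it stays below the
  -- constant `0`.
  have h1 := image_le_of_deriv_right_le_deriv_boundary hc hder (B := fun _ => 0) (B' := fun _ => 0)
    (by simp [h0]) continuousOn_const (fun s _ => hasDerivWithinAt_const _ _ _)
    (fun s hs => by have := hd s hs.1; linarith) (Set.right_mem_Icc.2 ht)
  change (inner ℂ (u t) (u t)).re ≤ 0 at h1
  rw [hsq] at h1
  exact norm_eq_zero.1 (pow_eq_zero_iff two_ne_zero |>.1 (le_antisymm h1 (sq_nonneg _)))

/-- A solution `u` of the evolution equation `u' = c A u`, where `v = A u`. -/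
structure IsTrajectory (A : X → X → Prop) (c : ℂ) (u v : ℝ≥0 → X) : Prop where
  continuous : Continuous u
  mem : ∀ t, A (u t) (v t)
  deriv : ∀ t, Tendsto (fun h : ℝ≥0 => ((h : ℝ) : ℂ)⁻¹ • (u (t + h) - u t)) (𝓝[>] 0)
    (𝓝 (c • v t))

theorem IsTrajectory.hasDerivWithinAt {A : X → X → Prop} {c : ℂ} {u v : ℝ≥0 → X}
    (h : IsTrajectory A c u v) {t : ℝ} (ht : 0 ≤ t) :
    HasDerivWithinAt (fun s : ℝ => u s.toNNReal) (c • v t.toNNReal) (Set.Ici t) t := by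
  rw [← hasDerivWithinAt_Ioi_iff_Ici, hasDerivWithinAt_iff_tendsto_slope' Set.self_notMem_Ioi]
  have hτ : Tendsto (fun s : ℝ => (s - t).toNNReal) (𝓝[>] t) (𝓝[>] 0) := by
    refine tendsto_nhdsWithin_iff.2 ⟨?_, ?_⟩
    · have : Continuous fun s : ℝ => (s - t).toNNReal := by fun_prop
      exact (this.tendsto' t 0 (by simp)).mono_left nhdsWithin_le_nhds
    · filter_upwards [self_mem_nhdsWithin] with s hs
      exact Real.toNNReal_pos.2 (sub_pos.2 hs)
  refine ((h.deriv t.toNNReal).comp hτ).congr' ?_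
  filter_upwards [self_mem_nhdsWithin] with s hs
  have hs' : 0 ≤ s - t := sub_nonneg.2 (le_of_lt hs)
  simp only [Function.comp_apply]
  rw [Real.coe_toNNReal _ hs', ← Real.toNNReal_add ht hs', add_sub_cancel, slope_def_module,
    ← Complex.ofReal_inv, Complex.coe_smul]

/-- The difference of two trajectories is again a solution, and dissipativity forces its norm not to
grow. -/
theorem IsTrajectory.unique {A : X → X → Prop} {c : ℂ}
    (hsub : ∀ f g f' g', A f g → A f' g' → A (f - f') (g - g'))
    (hdiss : ∀ f g, A f g → (inner ℂ f (c • g)).re ≤ 0) {u v u₁ v₁ : ℝ≥0 → X}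
    (h : IsTrajectory A c u v) (h₁ : IsTrajectory A c u₁ v₁) (h0 : u 0 = u₁ 0) : u = u₁ := by
  funext t
  have hcont : Continuous fun s : ℝ => u s.toNNReal - u₁ s.toNNReal :=
    (h.continuous.comp continuous_real_toNNReal).sub (h₁.continuous.comp continuous_real_toNNReal)
  have key := eq_zero_of_dissipative (u := fun s : ℝ => u s.toNNReal - u₁ s.toNNReal)
    (u' := fun s => c • v s.toNNReal - c • v₁ s.toNNReal) hcont.continuousOn
    (fun s hs => (h.hasDerivWithinAt hs).sub (h₁.hasDerivWithinAt hs))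
    (fun s _ => by
      rw [← smul_sub]
      exact hdiss _ _ (hsub _ _ _ _ (h.mem _) (h₁.mem _)))
    (by simp [h0]) t t.2
  rw [Real.toNNReal_coe] at key
  exact sub_eq_zero.1 key

theorem IsTrajectory.map {A : X → X → Prop} {c : ℂ} {u v : ℝ≥0 → X} (h : IsTrajectory A c u v)
    (Q : X →L[ℂ] X) (hQ : ∀ f g, A f g → A (Q f) (Q g)) :
    IsTrajectory A c (fun t => Q (u t)) (fun t => Q (v t)) where
  continuous := Q.continuous.comp h.continuous
  mem t := hQ _ _ (h.mem t)
  deriv t := by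
    have h1 := (Q.continuous.tendsto _).comp (h.deriv t)
    simpa only [Function.comp_def, map_smul, map_sub] using h1

theorem IsSemigroupGeneratedBy.isTrajectory {A : X → X → Prop} {T : ℝ≥0 → X →L[ℂ] X}
    (hT : IsSemigroupGeneratedBy A T) {f g : X} (hfg : A f g) :
    IsTrajectory A 1 (fun t => T t f) (fun t => T t g) := by
  have key : ∀ t, Tendsto (fun h : ℝ≥0 => ((h : ℝ) : ℂ)⁻¹ • (T (t + h) f - T t f)) (𝓝[>] 0)
      (𝓝 (T t g)) := by
    intro t
    have h1 := ((T t).continuous.tendsto _).comp ((hT.generator f g).1 hfg)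
    simpa only [Function.comp_def, map_smul, map_sub, ← hT.map_add] using h1
  refine ⟨hT.continuous f, fun t => ?_, fun t => by simpa only [one_smul] using key t⟩
  rw [hT.generator]
  simpa only [← hT.map_add, add_comm t] using key t

theorem IsUnitaryGroupGeneratedBy.isTrajectory {A : X → X → Prop} {U : ℝ → X ≃ₗᵢ[ℂ] X}
    (hU : IsUnitaryGroupGeneratedBy A U) {f g : X} (hfg : A f g) :
    IsTrajectory A Complex.I (fun t => U t f) (fun t => U t g) := by
  have key : ∀ t : ℝ, Tendsto (fun h : ℝ => (h : ℂ)⁻¹ • (U (t + h) f - U t f)) (𝓝[≠] 0)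
      (𝓝 (Complex.I • U t g)) := by
    intro t
    have h1 := ((U t).continuous.tendsto _).comp ((hU.generator f g).1 hfg)
    simpa only [Function.comp_def, map_smul, map_sub, ← hU.map_add] using h1
  have hτ : Tendsto (fun t : ℝ≥0 => (t : ℝ)) (𝓝[>] 0) (𝓝[≠] 0) := by
    refine tendsto_nhdsWithin_iff.2 ⟨?_, ?_⟩
    · exact (NNReal.continuous_coe.tendsto' 0 0 rfl).mono_left nhdsWithin_le_nhds
    · filter_upwards [self_mem_nhdsWithin] with t ht
      exact NNReal.coe_ne_zero.2 (ne_of_gt ht)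
  refine ⟨(hU.continuous f).comp NNReal.continuous_coe, fun t => ?_, fun t => ?_⟩
  · rw [hU.generator]
    simpa only [← hU.map_add, add_comm (t : ℝ)] using key t
  · simpa only [Function.comp_def, NNReal.coe_add] using (key t).comp hτ

theorem IsUnitaryGroupGeneratedBy.map_neg_apply {A : X → X → Prop} {U : ℝ → X ≃ₗᵢ[ℂ] X}
    (hU : IsUnitaryGroupGeneratedBy A U) (t : ℝ) (f : X) : U (-t) (U t f) = f := by
  rw [← hU.map_add, neg_add_cancel, hU.map_zero]

/-- If the semigroup is smoothing, `T t f` lies in the domain for `t > 0` and tends to `f` as `t →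
0`. -/
theorem IsSemigroupGeneratedBy.dense_domain {A : X → X → Prop} {T : ℝ≥0 → X →L[ℂ] X}
    (hT : IsSemigroupGeneratedBy A T) (h : ∀ t, 0 < t → ∀ f, ∃ g, A (T t f) g) :
    Dense {f : X | ∃ g, A f g} := by
  intro f
  have h1 : Tendsto (fun t : ℝ≥0 => T t f) (𝓝[>] 0) (𝓝 f) := by
    have h2 := (hT.continuous f).tendsto 0
    rw [hT.map_zero] at h2
    exact h2.mono_left nhdsWithin_le_nhds
  refine mem_closure_of_tendsto h1 ?_
  filter_upwards [self_mem_nhdsWithin] with t ht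
  exact h t ht f

/-- A densely defined linear relation `A` such that `Re (c A f | f) ≤ 0` whenever `Re c ≥ 0`. -/
structure IsDissipative (A : X → X → Prop) : Prop where
  sub : ∀ f g f' g', A f g → A f' g' → A (f - f') (g - g')
  re_inner_nonpos : ∀ c : ℂ, 0 ≤ c.re → ∀ f g, A f g → (inner ℂ f (c • g)).re ≤ 0
  dense : Dense {f : X | ∃ g, A f g}

/-- Operators commuting with the generator commute with the semigroup; in particular
the semigroup is determined by its generator. -/
theorem IsSemigroupGeneratedBy.commute_of_commute {A : X → X → Prop} (hA : IsDissipative A)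
    {T T₁ : ℝ≥0 → X →L[ℂ] X} (hT : IsSemigroupGeneratedBy A T)
    (hT₁ : IsSemigroupGeneratedBy A T₁) (Q : X →L[ℂ] X)
    (hQ : ∀ f g, A f g → A (Q f) (Q g)) (t : ℝ≥0) (f : X) : Q (T t f) = T₁ t (Q f) := by
  have hcl : IsClosed {f | Q (T t f) = T₁ t (Q f)} :=
    isClosed_eq (Q.continuous.comp (T t).continuous) ((T₁ t).continuous.comp Q.continuous)
  refine hcl.closure_subset_iff.2 ?_ (hA.dense f)
  rintro k ⟨g, hkg⟩
  exact congrFun (((hT.isTrajectory hkg).map Q hQ).unique hA.sub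
    (hA.re_inner_nonpos 1 (by simp)) (hT₁.isTrajectory (hQ _ _ hkg))
    (by simp only [hT.map_zero, hT₁.map_zero])) t

/-- Operators commuting with the generator commute with the unitary group; in particular
the unitary group is determined by its generator. -/
theorem IsUnitaryGroupGeneratedBy.commute_of_commute {A : X → X → Prop} (hA : IsDissipative A)
    {U U₁ : ℝ → X ≃ₗᵢ[ℂ] X} (hU : IsUnitaryGroupGeneratedBy A U)
    (hU₁ : IsUnitaryGroupGeneratedBy A U₁) (Q : X →L[ℂ] X)
    (hQ : ∀ f g, A f g → A (Q f) (Q g)) (t : ℝ) (f : X) : Q (U t f) = U₁ t (Q f) := by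
  have hpos : ∀ (t : ℝ≥0) (f : X), Q (U t f) = U₁ t (Q f) := by
    intro t f
    have hcl : IsClosed {f | Q (U t f) = U₁ t (Q f)} :=
      isClosed_eq (Q.continuous.comp (U t).continuous) ((U₁ t).continuous.comp Q.continuous)
    refine hcl.closure_subset_iff.2 ?_ (hA.dense f)
    rintro k ⟨g, hkg⟩
    exact congrFun (((hU.isTrajectory hkg).map Q hQ).unique hA.sub
      (hA.re_inner_nonpos Complex.I (by simp)) (hU₁.isTrajectory (hQ _ _ hkg))
      (by simp only [NNReal.coe_zero, hU.map_zero, hU₁.map_zero])) t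
  rcases le_total 0 t with ht | ht
  · exact hpos ⟨t, ht⟩ f
  -- Dissipativity only controls forward time. For `t ≤ 0` the case `-t` is applied to `U t f`, and
  -- `U₁ (-t)` is then inverted.
  · have h1 : Q (U (-t) (U t f)) = U₁ (-t) (Q (U t f)) := hpos ⟨-t, neg_nonneg.2 ht⟩ (U t f)
    rw [hU.map_neg_apply] at h1
    have h2 := hU₁.map_neg_apply (-t) (Q (U t f))
    rw [neg_neg, ← h1] at h2
    exact h2.symm

end Uniqueness

/-! ### Dissipativity of the Laplacian. -/

section LaplacianSemigroups

open FourierTransform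

variable {N : ℕ} {H : Type*} [NormedAddCommGroup H] [InnerProductSpace ℂ H] [CompleteSpace H]

theorem IsLaplacian.sub {f g f' g' : BochnerL2 N H} (h : IsLaplacian f g)
    (h' : IsLaplacian f' g') : IsLaplacian (f - f') (g - g') := by
  rw [isLaplacian_iff] at h h' ⊢
  have e : ∀ a b : BochnerL2 N H, (𝓕 (a - b) : BochnerL2 N H) = 𝓕 a - 𝓕 b :=
    (Lp.fourierTransformₗᵢ (EuclideanSpace ℝ (Fin N)) H).map_sub
  rw [e, e]
  filter_upwards [h, h', Lp.coeFn_sub (𝓕 f : BochnerL2 N H) (𝓕 f'),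
    Lp.coeFn_sub (𝓕 g : BochnerL2 N H) (𝓕 g')] with ξ h1 h2 h3 h4
  rw [h3, h4, Pi.sub_apply, Pi.sub_apply, h1, h2, smul_sub]

/-- Testing the form with `v = f` gives minus the sum of `‖∂_j f‖²`. That this is real is what makes
both `A` and `iA` dissipative. -/
theorem IsLaplacian.inner_eq {f g : BochnerL2 N H} (h : IsLaplacian f g) :
    ∃ r : ℝ, 0 ≤ r ∧ inner ℂ f g = ((-r : ℝ) : ℂ) := by
  obtain ⟨F, hF, h⟩ := h
  refine ⟨∑ j, ‖F j‖ ^ 2, Finset.sum_nonneg fun j _ => sq_nonneg _, ?_⟩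
  rw [Complex.ofReal_neg, eq_neg_iff_add_eq_zero, ← neg_eq_iff_add_eq_zero, ← h f F hF]
  push_cast
  exact Finset.sum_congr rfl fun j _ => by rw [inner_self_eq_norm_sq_to_K]; rfl

theorem IsLaplacian.re_inner_smul_nonpos {c : ℂ} (hc : 0 ≤ c.re) (f g : BochnerL2 N H)
    (h : IsLaplacian f g) : (inner ℂ f (c • g)).re ≤ 0 := by
  obtain ⟨r, hr, h⟩ := h.inner_eq
  rw [inner_smul_right, h, Complex.re_mul_ofReal]
  nlinarith

theorem exists_isLaplacian_heatOp {t : ℝ≥0} (ht : 0 < t) (f : BochnerL2 N H) :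
    ∃ g, IsLaplacian (heatOp t f) g := by
  have h1 := fourier_expLaplace _ (heat_re_nonpos t) f
  have hsym := continuous_laplaceSymbol (N := N)
  have hmem : MemLp (fun ξ => (-(laplaceSymbol ξ : ℂ)) • (𝓕 (heatOp t f) : BochnerL2 N H) ξ) 2
      volume := by
    refine (Lp.memLp (𝓕 f)).of_le_mul (c := (t : ℝ)⁻¹)
      ((Continuous.aestronglyMeasurable (by fun_prop)).smul (Lp.aestronglyMeasurable _)) ?_
    filter_upwards [h1] with ξ hξ
    simp only [heatOp]
    rw [hξ, norm_smul, norm_smul, ← mul_assoc]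
    gcongr
    have ha := laplaceSymbol_nonneg ξ
    have h2 : (((t : ℝ) : ℂ) * (-1) * (laplaceSymbol ξ : ℂ)).re = -(t * laplaceSymbol ξ) := by
      simp
    have ht' : (0 : ℝ) < t := ht
    rw [Complex.norm_exp, h2, norm_neg, Complex.norm_real, Real.norm_of_nonneg ha, Real.exp_neg,
      ← div_eq_mul_inv, div_le_iff₀ (Real.exp_pos _), inv_mul_eq_div, le_div_iff₀ ht']
    -- This is the smoothing bound `s e^{-ts} ≤ 1/t` for `s ≥ 0`.
    have := Real.add_one_le_exp (t * laplaceSymbol ξ)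
    linarith
  obtain ⟨g, hg⟩ := exists_Lp_fourier_eq hmem
  exact ⟨g, isLaplacian_iff.2 hg⟩

theorem dense_domain_laplacian : Dense {f : BochnerL2 N H | ∃ g, IsLaplacian f g} :=
  heatOp_isSemigroupGeneratedBy.dense_domain fun _ ht f => exists_isLaplacian_heatOp ht f

theorem isDissipative_laplacian : IsDissipative (IsLaplacian (N := N) (H := H)) where
  sub _ _ _ _ := IsLaplacian.sub
  re_inner_nonpos _ hc := IsLaplacian.re_inner_smul_nonpos hc
  dense := dense_domain_laplacian

end LaplacianSemigroups

/-! ### Real Hilbert lattices. -/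

section RealHilbertLattice

variable {E : Type*} [NormedAddCommGroup E] [InnerProductSpace ℝ E]
  [Lattice E] [IsOrderedAddMonoid E] [IsOrderedModule ℝ E] [HasSolidNorm E]

/-- Since `|x - y| ≤ x + y`, the lattice norm gives `‖x - y‖ ≤ ‖x + y‖`; expanding the squares
leaves `0 ≤ 4 (x | y)`. -/
theorem real_inner_nonneg_of_nonneg {E : Type*} [NormedAddCommGroup E] [InnerProductSpace ℝ E]
    [Lattice E] [IsOrderedAddMonoid E] [HasSolidNorm E]
    {x y : E} (hx : 0 ≤ x) (hy : 0 ≤ y) : 0 ≤ inner ℝ x y := by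
  have h : ‖x - y‖ ≤ ‖x + y‖ := by
    apply HasSolidNorm.solid
    rw [abs_of_nonneg (add_nonneg hx hy)]
    refine abs_le'.2 ⟨(sub_le_self x hy).trans (le_add_of_nonneg_right hy), ?_⟩
    rw [neg_sub]
    exact (sub_le_self y hx).trans (le_add_of_nonneg_left hx)
  have h1 := pow_le_pow_left₀ (norm_nonneg _) h 2
  rw [norm_add_sq_real, norm_sub_sq_real] at h1
  linarith

theorem real_inner_le_of_le {E : Type*} [NormedAddCommGroup E] [InnerProductSpace ℝ E]
    [Lattice E] [IsOrderedAddMonoid E] [HasSolidNorm E]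
    {u x y : E} (hu : 0 ≤ u) (h : x ≤ y) : inner ℝ u x ≤ inner ℝ u y := by
  have := real_inner_nonneg_of_nonneg hu (sub_nonneg.2 h)
  rwa [inner_sub_right, sub_nonneg] at this

/-- The vectors `|x| = x⁺ + x⁻` and `x = x⁺ - x⁻` have equal norm, so polarization kills the mixed
term. -/
theorem real_inner_posPart_negPart {E : Type*} [NormedAddCommGroup E] [InnerProductSpace ℝ E]
    [Lattice E] [IsOrderedAddMonoid E] [HasSolidNorm E]
    (x : E) : inner ℝ (x⁺) (x⁻) = 0 := by
  have h : ‖x⁺ + x⁻‖ ^ 2 = ‖x⁺ - x⁻‖ ^ 2 := by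
    rw [posPart_add_negPart, posPart_sub_negPart, norm_abs_eq_norm]
  rw [norm_add_sq_real, norm_sub_sq_real] at h
  linarith

theorem abs_smul_le {E : Type*} [NormedAddCommGroup E] [InnerProductSpace ℝ E]
    [Lattice E] [IsOrderedModule ℝ E] (a : ℝ) (x : E) : |a • x| ≤ |a| • |x| := by
  have key : ∀ z : E, a • z ≤ |a| • |z| := by
    intro z
    rcases le_total 0 a with ha | ha
    · rw [abs_of_nonneg ha]
      exact smul_le_smul_of_nonneg_left (le_abs_self z) ha
    · rw [abs_of_nonpos ha, ← neg_smul_neg]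
      exact smul_le_smul_of_nonneg_left (neg_le_abs z) (neg_nonneg.2 ha)
  refine abs_le'.2 ⟨key x, ?_⟩
  rw [← smul_neg, ← abs_neg x]
  exact key (-x)

/-- A totally ordered Hilbert lattice is spanned by every positive unit vector. -/
theorem eq_inner_smul_of_total {E : Type*} [NormedAddCommGroup E] [InnerProductSpace ℝ E]
    [Lattice E] [IsOrderedAddMonoid E] [HasSolidNorm E]
    (htot : ∀ x : E, x ≤ 0 ∨ 0 ≤ x) {e : E} (he : 0 ≤ e)
    (h1 : ‖e‖ = 1) (y : E) : y = (inner ℝ e y : ℝ) • e := by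
  have hee : inner ℝ e e = (1 : ℝ) := by rw [real_inner_self_eq_norm_sq, h1, one_pow]
  -- Totality compares `r` with `e`. From `r ≤ e` one gets `(r | r) ≤ (r | e) = 0`; from `e ≤ r` the
  -- contradiction `1 = (e | e) ≤ (e | r) = 0`.
  have key : ∀ r : E, 0 ≤ r → inner ℝ e r = (0 : ℝ) → r = 0 := by
    intro r hr h0
    rcases htot (r - e) with h | h
    · have h3 : inner ℝ r r ≤ (0 : ℝ) := by
        have := real_inner_le_of_le hr (sub_nonpos.1 h)
        rwa [← real_inner_comm r e, h0] at this
      exact inner_self_eq_zero.1 (le_antisymm h3 (real_inner_nonneg_of_nonneg hr hr))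
    · have h2 := real_inner_le_of_le he (sub_nonneg.1 h)
      rw [hee, h0] at h2
      exact absurd h2 (by norm_num)
  have horth : inner ℝ e (y - (inner ℝ e y : ℝ) • e) = (0 : ℝ) := by
    rw [inner_sub_right, inner_smul_right, hee, mul_one, sub_self]
  rcases htot (y - (inner ℝ e y : ℝ) • e) with h | h
  · have := key (-(y - (inner ℝ e y : ℝ) • e)) (neg_nonneg.2 h)
      (by rw [inner_neg_right, horth, neg_zero])
    exact sub_eq_zero.1 (neg_eq_zero.1 this)
  · exact sub_eq_zero.1 (key _ h horth)

theorem exists_nonneg_norm_eq_one [Nontrivial E] : ∃ e : E, 0 ≤ e ∧ ‖e‖ = 1 := by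
  obtain ⟨x, hx⟩ := exists_ne (0 : E)
  refine ⟨‖x‖⁻¹ • |x|, smul_nonneg (by positivity) (abs_nonneg x), ?_⟩
  rw [norm_smul, norm_abs_eq_norm, norm_inv, norm_norm, inv_mul_cancel₀ (norm_ne_zero_iff.2 hx)]

end RealHilbertLattice

/-! ### Modulus and closed ideals of complex Hilbert lattices. -/

namespace ComplexHilbertLattice

variable {E H : Type*}
  [NormedAddCommGroup E] [InnerProductSpace ℝ E] [CompleteSpace E]
  [Lattice E] [IsOrderedAddMonoid E] [IsOrderedModule ℝ E] [HasSolidNorm E]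
  [NormedAddCommGroup H] [InnerProductSpace ℂ H] [CompleteSpace H]

theorem smul_ofReal (L : ComplexHilbertLattice E H) (z : ℂ) (x : E) :
    z • L.ofReal x = L.ofReal (z.re • x) + Complex.I • L.ofReal (z.im • x) := by
  conv_lhs => rw [← Complex.re_add_im z]
  rw [add_smul, map_smul, map_smul, Complex.coe_smul, mul_comm, mul_smul, Complex.coe_smul]

theorem smul_eq (L : ComplexHilbertLattice E H) (z : ℂ) (x y : E) :
    z • (L.ofReal x + Complex.I • L.ofReal y) =
      L.ofReal (z.re • x - z.im • y) + Complex.I • L.ofReal (z.im • x + z.re • y) := by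
  rw [smul_add, smul_comm z Complex.I, smul_ofReal L z x, smul_ofReal L z y, map_sub,
    map_add, smul_add, smul_add,
    smul_smul, Complex.I_mul_I, neg_one_smul]
  abel

theorem re_smul_ofReal (L : ComplexHilbertLattice E H) (z : ℂ) (x : E) :
    L.re (z • L.ofReal x) = z.re • x := by
  rw [smul_ofReal, L.re_eq]

/-- The real part as a continuous real linear map. -/
noncomputable def reCLM (L : ComplexHilbertLattice E H) : H →L[ℝ] E :=
  LinearMap.mkContinuous
    { toFun := L.re
      map_add' := fun h k => by
        obtain ⟨x, y, rfl⟩ := L.exists_re_im h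
        obtain ⟨x', y', rfl⟩ := L.exists_re_im k
        rw [add_add_add_comm, ← smul_add, ← map_add, ← map_add, L.re_eq, L.re_eq, L.re_eq]
      map_smul' := fun c h => by
        obtain ⟨x, y, rfl⟩ := L.exists_re_im h
        rw [← Complex.coe_smul, smul_eq, L.re_eq, L.re_eq]
        simp } 1 fun h => by
    obtain ⟨x, y, rfl⟩ := L.exists_re_im h
    change ‖L.re _‖ ≤ _
    rw [L.re_eq, one_mul]
    refine le_of_sq_le_sq ?_ (norm_nonneg _)
    rw [@norm_add_sq ℂ, inner_smul_right, L.inner_ofReal, norm_smul, L.ofReal.norm_map,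
      L.ofReal.norm_map]
    simp only [RCLike.re_to_complex, Complex.I_mul_re, Complex.ofReal_im]
    nlinarith [sq_nonneg (‖Complex.I‖ * ‖y‖)]

/-- The imaginary part as a continuous real linear map. -/
noncomputable def imCLM (L : ComplexHilbertLattice E H) : H →L[ℝ] E :=
  L.reCLM ∘L ((-Complex.I) • ContinuousLinearMap.id ℝ H)

theorem reCLM_eq (L : ComplexHilbertLattice E H) (x y : E) :
    L.reCLM (L.ofReal x + Complex.I • L.ofReal y) = x := L.re_eq x y

theorem imCLM_eq (L : ComplexHilbertLattice E H) (x y : E) :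
    L.imCLM (L.ofReal x + Complex.I • L.ofReal y) = y := by
  change L.re ((-Complex.I) • (L.ofReal x + Complex.I • L.ofReal y)) = y
  rw [smul_eq, L.re_eq]
  simp

theorem modulus_ge_cos_sin (L : ComplexHilbertLattice E H) (x y : E) (θ : ℝ) :
    Real.cos θ • x - Real.sin θ • y ≤ L.modulus (L.ofReal x + Complex.I • L.ofReal y) := by
  refine (L.isLUB_modulus _).1 ⟨θ, ?_⟩
  change L.re (Complex.exp (θ * Complex.I) • _) = _
  rw [smul_eq, L.re_eq, Complex.exp_ofReal_mul_I_re, Complex.exp_ofReal_mul_I_im]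

theorem abs_re_le_modulus (L : ComplexHilbertLattice E H) (x y : E) :
    |x| ≤ L.modulus (L.ofReal x + Complex.I • L.ofReal y) := by
  refine abs_le'.2 ⟨?_, ?_⟩
  · simpa using L.modulus_ge_cos_sin x y 0
  · simpa using L.modulus_ge_cos_sin x y Real.pi

theorem abs_im_le_modulus (L : ComplexHilbertLattice E H) (x y : E) :
    |y| ≤ L.modulus (L.ofReal x + Complex.I • L.ofReal y) := by
  refine abs_le'.2 ⟨?_, ?_⟩
  · simpa using L.modulus_ge_cos_sin x y (-(Real.pi / 2))
  · simpa using L.modulus_ge_cos_sin x y (Real.pi / 2)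

/-- With the lower bounds `|x|` and `|y|`, this controls the modulus well enough to test solidity of
an ideal on real and imaginary parts, without a formula for the modulus. -/
theorem modulus_le_abs_add_abs (L : ComplexHilbertLattice E H) (x y : E) :
    L.modulus (L.ofReal x + Complex.I • L.ofReal y) ≤ |x| + |y| := by
  refine (L.isLUB_modulus _).2 ?_
  rintro _ ⟨θ, rfl⟩
  change L.re (Complex.exp (θ * Complex.I) • _) ≤ _
  rw [smul_eq, L.re_eq, Complex.exp_ofReal_mul_I_re, Complex.exp_ofReal_mul_I_im, sub_eq_add_neg,
    ← neg_smul]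
  have key : ∀ (c : ℝ) (z : E), |c| ≤ 1 → c • z ≤ |z| := by
    intro c z hc
    calc c • z ≤ |c • z| := le_abs_self _
      _ ≤ |c| • |z| := abs_smul_le c z
      _ ≤ (1 : ℝ) • |z| := smul_le_smul_of_nonneg_right hc (abs_nonneg z)
      _ = |z| := one_smul _ _
  exact add_le_add (key _ _ (Real.abs_cos_le_one θ))
    (key _ _ (by rw [abs_neg]; exact Real.abs_sin_le_one θ))

theorem modulus_nonneg (L : ComplexHilbertLattice E H) (h : H) : 0 ≤ L.modulus h := by
  obtain ⟨x, y, rfl⟩ := L.exists_re_im h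
  exact (abs_nonneg x).trans (L.abs_re_le_modulus x y)

/-- The supremum is attained at the angle `-arg z`. -/
theorem modulus_smul_ofReal (L : ComplexHilbertLattice E H) (z : ℂ) {e : E} (he : 0 ≤ e) :
    L.modulus (z • L.ofReal e) = ‖z‖ • e := by
  refine (L.isLUB_modulus _).unique (IsGreatest.isLUB ⟨⟨-z.arg, ?_⟩, ?_⟩)
  · change L.re (Complex.exp (((-z.arg : ℝ) : ℂ) * Complex.I) • z • L.ofReal e) = _
    rw [smul_smul, re_smul_ofReal]
    congr 1
    conv_lhs => rw [← Complex.norm_mul_exp_arg_mul_I z]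
    rw [mul_left_comm, ← Complex.exp_add]
    simp
  · rintro _ ⟨θ, rfl⟩
    change L.re (Complex.exp (θ * Complex.I) • z • L.ofReal e) ≤ _
    rw [smul_smul, re_smul_ofReal]
    refine smul_le_smul_of_nonneg_right ?_ he
    refine (Complex.re_le_norm _).trans ?_
    rw [norm_mul, Complex.norm_exp_ofReal_mul_I, one_mul]

/-- The closed ideal of all vectors disjoint from the positive vector `u`. -/
noncomputable def disjointIdeal (L : ComplexHilbertLattice E H) {u : E} (hu : 0 ≤ u) :
    Submodule ℂ H where
  carrier := {h | inner ℝ u |L.reCLM h| = (0 : ℝ) ∧ inner ℝ u |L.imCLM h| = (0 : ℝ)}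
  zero_mem' := by simp
  add_mem' := by
    rintro h k ⟨h1, h2⟩ ⟨k1, k2⟩
    simp only [Set.mem_ofPred_eq, map_add]
    constructor <;> refine le_antisymm ?_ (real_inner_nonneg_of_nonneg hu (abs_nonneg _)) <;>
      refine (real_inner_le_of_le hu (abs_add_le _ _)).trans ?_ <;> rw [inner_add_right]
    · rw [h1, k1, add_zero]
    · rw [h2, k2, add_zero]
  smul_mem' := by
    rintro c h ⟨h1, h2⟩
    obtain ⟨x, y, rfl⟩ := L.exists_re_im h
    rw [reCLM_eq] at h1
    rw [imCLM_eq] at h2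
    have key : ∀ a b : ℝ, inner ℝ u |a • x + b • y| = (0 : ℝ) := by
      intro a b
      refine le_antisymm ?_ (real_inner_nonneg_of_nonneg hu (abs_nonneg _))
      refine (real_inner_le_of_le hu ((abs_add_le _ _).trans
        (add_le_add (abs_smul_le a x) (abs_smul_le b y)))).trans ?_
      rw [inner_add_right, inner_smul_right, inner_smul_right, h1, h2]
      simp
    rw [Set.mem_ofPred_eq, smul_eq, reCLM_eq, imCLM_eq, sub_eq_add_neg, ← neg_smul]
    exact ⟨key _ _, key _ _⟩

theorem mem_disjointIdeal_iff (L : ComplexHilbertLattice E H) {u : E} (hu : 0 ≤ u) (x y : E) :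
    L.ofReal x + Complex.I • L.ofReal y ∈ L.disjointIdeal hu ↔
      inner ℝ u |x| = (0 : ℝ) ∧ inner ℝ u |y| = (0 : ℝ) := by
  change inner ℝ u |L.reCLM _| = (0 : ℝ) ∧ inner ℝ u |L.imCLM _| = (0 : ℝ) ↔ _
  rw [reCLM_eq, imCLM_eq]

theorem ofReal_mem_disjointIdeal_iff (L : ComplexHilbertLattice E H) {u : E} (hu : 0 ≤ u) (x : E) :
    L.ofReal x ∈ L.disjointIdeal hu ↔ inner ℝ u |x| = (0 : ℝ) := by
  have := L.mem_disjointIdeal_iff hu x 0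
  simpa using this

/-- Disjointness from `u` is expressed by orthogonality of `u` to absolute values, a closed
condition that is monotone because the inner product with `u ≥ 0` is. -/
theorem isClosedIdeal_disjointIdeal (L : ComplexHilbertLattice E H) {u : E} (hu : 0 ≤ u) :
    L.IsClosedIdeal (L.disjointIdeal hu) where
  isClosed := by
    have habs : Continuous fun x : E => |x| :=
      (LipschitzWith.of_dist_le_mul (K := 1) fun x y => by
        rw [dist_eq_norm, dist_eq_norm, NNReal.coe_one, one_mul]
        exact norm_abs_sub_abs x y).continuous
    exact (isClosed_eq (continuous_const.inner (habs.comp L.reCLM.continuous))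
      continuous_const).inter (isClosed_eq
        (continuous_const.inner (habs.comp L.imCLM.continuous)) continuous_const)
  solid f hf g hgf := by
    obtain ⟨x, y, rfl⟩ := L.exists_re_im f
    obtain ⟨x', y', rfl⟩ := L.exists_re_im g
    rw [mem_disjointIdeal_iff] at hf ⊢
    have h1 : inner ℝ u (|x| + |y|) = (0 : ℝ) := by rw [inner_add_right, hf.1, hf.2, add_zero]
    have h2 := hgf.trans (L.modulus_le_abs_add_abs x y)
    constructor <;> refine le_antisymm ?_ (real_inner_nonneg_of_nonneg hu (abs_nonneg _)) <;>
      rw [← h1]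
    · exact real_inner_le_of_le hu ((L.abs_re_le_modulus x' y').trans h2)
    · exact real_inner_le_of_le hu ((L.abs_im_le_modulus x' y').trans h2)

/-- The isomorphism is the inner product with `e`, which sends `z e` to `z`; the modulus of `z e` is
`‖z‖ e`. -/
theorem isScalar_of_span (L : ComplexHilbertLattice E H) {e : E} (he : 0 ≤ e) (h1 : ‖e‖ = 1)
    (hspan : ∀ y : E, ∃ c : ℝ, y = c • e) : L.IsScalar := by
  have hspanH : ∀ h : H, ∃ z : ℂ, h = z • L.ofReal e := by
    intro h
    obtain ⟨x, y, rfl⟩ := L.exists_re_im h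
    obtain ⟨a, ha⟩ := hspan x
    obtain ⟨b, hb⟩ := hspan y
    exact ⟨⟨a, b⟩, by rw [smul_ofReal L ⟨a, b⟩, ha, hb]⟩
  have hval : ∀ z : ℂ, inner ℂ (L.ofReal e) (z • L.ofReal e) = z := by
    intro z
    rw [inner_smul_right, L.inner_ofReal, real_inner_self_eq_norm_sq, h1]
    simp
  let φ : H →ₗᵢ[ℂ] ℂ := ⟨(innerSL ℂ (L.ofReal e) : H →ₗ[ℂ] ℂ), fun h => by
    obtain ⟨z, rfl⟩ := hspanH h
    change ‖inner ℂ (L.ofReal e) (z • L.ofReal e)‖ = _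
    rw [hval, norm_smul, L.ofReal.norm_map, h1, mul_one]⟩
  have hφ : ∀ z : ℂ, φ (z • L.ofReal e) = z := hval
  refine ⟨LinearIsometryEquiv.ofSurjective φ fun z => ⟨z • L.ofReal e, hφ z⟩, fun h => ?_⟩
  obtain ⟨z, rfl⟩ := hspanH h
  change φ (L.ofReal (L.modulus (z • L.ofReal e))) = ((‖φ (z • L.ofReal e)‖ : ℝ) : ℂ)
  rw [hφ, modulus_smul_ofReal L z he, map_smul, ← Complex.coe_smul, hφ]

theorem nontrivial_real (L : ComplexHilbertLattice E H) [Nontrivial H] : Nontrivial E := by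
  obtain ⟨h, hh⟩ := exists_ne (0 : H)
  by_contra hE
  rw [not_nontrivial_iff_subsingleton] at hE
  obtain ⟨x, y, rfl⟩ := L.exists_re_im h
  rw [Subsingleton.elim x 0, Subsingleton.elim y 0] at hh
  simp at hh

/-- A complex Hilbert lattice without nontrivial closed ideals is `ℂ`. -/
theorem isScalar_of_forall_isClosedIdeal (L : ComplexHilbertLattice E H) [Nontrivial H]
    (h : ∀ I, L.IsClosedIdeal I → I = ⊥ ∨ I = ⊤) : L.IsScalar := by
  have hE := L.nontrivial_real
  obtain ⟨e, he, h1⟩ := exists_nonneg_norm_eq_one (E := E)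
  refine L.isScalar_of_span he h1 fun y => ⟨_, eq_inner_smul_of_total (fun x => ?_) he h1 y⟩
  -- The ideal disjoint from `x⁺` contains `x⁻`. If it is zero then `x⁻ = 0`; if it is everything
  -- then `x⁺` is orthogonal to itself.
  rcases h _ (L.isClosedIdeal_disjointIdeal (posPart_nonneg x)) with hI | hI
  · right
    have h2 : L.ofReal (x⁻) ∈ L.disjointIdeal (posPart_nonneg x) := by
      rw [ofReal_mem_disjointIdeal_iff, abs_of_nonneg (negPart_nonneg x),
        real_inner_posPart_negPart]
    rw [hI, Submodule.mem_bot] at h2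
    exact negPart_eq_zero.1 (L.ofReal.injective (h2.trans (map_zero _).symm))
  · left
    have h2 : L.ofReal (x⁺) ∈ L.disjointIdeal (posPart_nonneg x) := by
      rw [hI]; exact Submodule.mem_top
    rw [ofReal_mem_disjointIdeal_iff, abs_of_nonneg (posPart_nonneg x), inner_self_eq_zero] at h2
    exact posPart_eq_zero.1 h2

theorem isScalar_of_finrank_eq_one (L : ComplexHilbertLattice E H) [Nontrivial H]
    (h : Module.finrank ℂ H = 1) : L.IsScalar := by
  have hE := L.nontrivial_real
  obtain ⟨e, he, h1⟩ := exists_nonneg_norm_eq_one (E := E)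
  refine L.isScalar_of_span he h1 fun y => ?_
  have he0 : L.ofReal e ≠ 0 := by
    rw [← norm_ne_zero_iff, L.ofReal.norm_map, h1]
    exact one_ne_zero
  obtain ⟨c, hc⟩ := (finrank_eq_one_iff_of_nonzero' _ he0).1 h (L.ofReal y)
  refine ⟨c.re, ?_⟩
  rw [← L.re_smul_ofReal, hc]
  simpa using (L.re_eq y 0).symm

/-- If `H = ℂ`, then moduli are compared by norms. -/
theorem IsScalar.modulus_le_iff {L : ComplexHilbertLattice E H} (hL : L.IsScalar) (f g : H) :
    L.modulus g ≤ L.modulus f ↔ ‖g‖ ≤ ‖f‖ := by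
  obtain ⟨Φ, hΦ⟩ := hL
  have hnorm : ∀ h, ‖L.modulus h‖ = ‖h‖ := by
    intro h
    rw [← L.ofReal.norm_map, ← Φ.norm_map, hΦ, Complex.norm_real, norm_norm, Φ.norm_map]
  constructor
  · intro h
    rw [← hnorm, ← hnorm f]
    refine HasSolidNorm.solid ?_
    rwa [abs_of_nonneg (L.modulus_nonneg g), abs_of_nonneg (L.modulus_nonneg f)]
  · intro h
    rcases eq_or_ne f 0 with rfl | hf
    · rw [norm_zero, norm_le_zero_iff] at h
      rw [h]
    · have hf' : ‖f‖ ≠ 0 := norm_ne_zero_iff.2 hf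
      -- In `ℂ` all moduli lie on one ray, so they are proportional with ratio given by the norms.
      have h1 : L.modulus g = (‖g‖ / ‖f‖) • L.modulus f := by
        apply L.ofReal.injective
        apply Φ.injective
        rw [map_smul, ← Complex.coe_smul, map_smul, hΦ, hΦ, Φ.norm_map, Φ.norm_map, smul_eq_mul,
          ← Complex.ofReal_mul, div_mul_cancel₀ _ hf']
      rw [h1]
      conv_rhs => rw [← one_smul ℝ (L.modulus f)]
      exact smul_le_smul_of_nonneg_right ((div_le_one (by positivity)).2 h) (L.modulus_nonneg f)

end ComplexHilbertLattice

/-! ### The invariant subspaces `L²(ℝ^N; I)`. -/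

section ValuedIn

open FourierTransform

variable {N : ℕ} {H : Type*} [NormedAddCommGroup H] [InnerProductSpace ℂ H] [CompleteSpace H]

/-- The Fourier transform commutes with the pointwise application of an operator. -/
theorem fourier_compLpL (P : H →L[ℂ] H) (f : BochnerL2 N H) :
    (𝓕 (P.compLpL 2 volume f) : BochnerL2 N H) = P.compLpL 2 volume (𝓕 f) := by
  have key : ∀ (k : BochnerL2 N H) (u : 𝓢(EuclideanSpace ℝ (Fin N), ℂ)),
      ((P.compLpL 2 volume k : BochnerL2 N H) : 𝓢'(EuclideanSpace ℝ (Fin N), H)) u =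
        P ((k : 𝓢'(EuclideanSpace ℝ (Fin N), H)) u) := by
    intro k u
    have hint : Integrable fun x => u x • k x :=
      memLp_one_iff_integrable.1 ((Lp.memLp k).smul (u.memLp 2 volume))
    rw [Lp.toTemperedDistribution_apply, Lp.toTemperedDistribution_apply,
      ← P.integral_comp_comm hint]
    refine integral_congr_ae ?_
    filter_upwards [P.coeFn_compLpL (p := 2) (μ := volume) k] with x hx
    rw [hx, map_smul]
  refine Lp_toTemperedDistribution_injective ?_
  change ((𝓕 (P.compLpL 2 volume f) : BochnerL2 N H) : 𝓢'(EuclideanSpace ℝ (Fin N), H)) =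
    ((P.compLpL 2 volume (𝓕 f) : BochnerL2 N H) : 𝓢'(EuclideanSpace ℝ (Fin N), H))
  ext u
  rw [key, ← Lp.fourier_toTemperedDistribution_eq, ← Lp.fourier_toTemperedDistribution_eq,
    TemperedDistribution.fourier_apply, TemperedDistribution.fourier_apply, key]

/-- A pointwise operator commutes with multiplication by the scalar symbol, hence it can serve as
`Q` in the commutation theorems. -/
theorem IsLaplacian.compLpL (P : H →L[ℂ] H) (f g : BochnerL2 N H) (h : IsLaplacian f g) :
    IsLaplacian (P.compLpL 2 volume f) (P.compLpL 2 volume g) := by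
  rw [isLaplacian_iff] at h ⊢
  rw [fourier_compLpL, fourier_compLpL]
  filter_upwards [h, P.coeFn_compLpL (p := 2) (μ := volume) (𝓕 f : BochnerL2 N H),
    P.coeFn_compLpL (p := 2) (μ := volume) (𝓕 g : BochnerL2 N H)] with ξ h1 h2 h3
  rw [h3, h2, h1, map_smul]

/-- As the fixed space of a bounded operator, the subspace is closed, and it is invariant under
everything that commutes with the operator. -/
theorem mem_valuedIn_iff_compLpL {N : ℕ} {H : Type*} [NormedAddCommGroup H] [InnerProductSpace ℂ H]
    (I : Submodule ℂ H) [I.HasOrthogonalProjection]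
    (f : BochnerL2 N H) : f ∈ valuedIn N I ↔ I.starProjection.compLpL 2 volume f = f := by
  rw [Lp.ext_iff]
  have h := I.starProjection.coeFn_compLpL (p := 2) (μ := volume) f
  change (∀ᵐ x, f x ∈ I) ↔ _
  constructor
  · intro hf
    filter_upwards [h, hf] with x h1 h2
    rw [h1]
    exact Submodule.starProjection_eq_self_iff.2 h2
  · intro hf
    filter_upwards [h, hf] with x h1 h2
    exact Submodule.starProjection_eq_self_iff.1 (h1.symm.trans h2)

theorem isClosed_valuedIn {N : ℕ} {H : Type*} [NormedAddCommGroup H] [InnerProductSpace ℂ H]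
    (I : Submodule ℂ H) [I.HasOrthogonalProjection] :
    IsClosed (valuedIn N I : Set (BochnerL2 N H)) := by
  have : (valuedIn N I : Set (BochnerL2 N H)) = {f | I.starProjection.compLpL 2 volume f = f} :=
    Set.ext fun f => mem_valuedIn_iff_compLpL I f
  rw [this]
  exact isClosed_eq (I.starProjection.compLpL 2 volume).continuous continuous_id

theorem isInvariantUnder_semigroup_valuedIn (I : Submodule ℂ H) [I.HasOrthogonalProjection]
    {T : ℝ≥0 → BochnerL2 N H →L[ℂ] BochnerL2 N H} (hT : IsSemigroupGeneratedBy IsLaplacian T) :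
    IsInvariantUnder (fun t f => T t f) (valuedIn N I) := by
  intro t f hf
  rw [mem_valuedIn_iff_compLpL] at hf ⊢
  have := hT.commute_of_commute isDissipative_laplacian hT _ (IsLaplacian.compLpL I.starProjection)
    t f
  rwa [hf] at this

theorem isInvariantUnder_unitaryGroup_valuedIn (I : Submodule ℂ H) [I.HasOrthogonalProjection]
    {U : ℝ → BochnerL2 N H ≃ₗᵢ[ℂ] BochnerL2 N H}
    (hU : IsUnitaryGroupGeneratedBy IsLaplacian U) :
    IsInvariantUnder (fun t f => U t f) (valuedIn N I) := by
  intro t f hf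
  rw [mem_valuedIn_iff_compLpL] at hf ⊢
  have := hU.commute_of_commute isDissipative_laplacian hU _ (IsLaplacian.compLpL I.starProjection)
    t f
  rwa [hf] at this

/-- The function equals `v` on the unit ball, a set of finite positive measure, and vanishes
elsewhere. It does not depend on `I`, so one function can be tested against several subspaces. -/
theorem exists_mem_valuedIn_iff {H : Type*} [NormedAddCommGroup H] [InnerProductSpace ℂ H]
    (N : ℕ) (v : H) :
    ∃ f : BochnerL2 N H, ∀ I : Submodule ℂ H, f ∈ valuedIn N I ↔ v ∈ I := by
  set B := Metric.ball (0 : EuclideanSpace ℝ (Fin N)) 1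
  have hB : MeasurableSet B := Metric.isOpen_ball.measurableSet
  have hfin : volume B ≠ ∞ := measure_ball_lt_top.ne
  have hpos : volume B ≠ 0 := (Metric.measure_ball_pos volume _ one_pos).ne'
  refine ⟨indicatorConstLp 2 hB hfin v, fun I => ?_⟩
  have h := indicatorConstLp_coeFn (p := 2) (hs := hB) (hμs := hfin) (c := v)
  change (∀ᵐ x, indicatorConstLp 2 hB hfin v x ∈ I) ↔ _
  constructor
  · intro hI
    by_contra hv
    refine hpos (measure_mono_null ?_ (ae_iff.1 (h.and hI)))
    intro x hx
    change ¬ (_ ∧ _)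
    rintro ⟨h1, h2⟩
    rw [h1, Set.indicator_of_mem hx] at h2
    exact hv h2
  · intro hv
    filter_upwards [h] with x hx
    rw [hx]
    by_cases hxB : x ∈ B
    · rwa [Set.indicator_of_mem hxB]
    · rw [Set.indicator_of_notMem hxB]
      exact I.zero_mem

theorem eq_bot_of_valuedIn_eq_bot {N : ℕ} {H : Type*} [NormedAddCommGroup H] [InnerProductSpace ℂ H]
    {I : Submodule ℂ H} (h : valuedIn N I = ⊥) : I = ⊥ := by
  refine (Submodule.eq_bot_iff I).2 fun v hv => ?_
  obtain ⟨f, hf⟩ := exists_mem_valuedIn_iff N v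
  have h1 := (hf I).2 hv
  rw [h, Submodule.mem_bot] at h1
  -- The same function, tested against the zero subspace, turns `f = 0` into `v = 0`.
  have h2 := (hf ⊥).1 (by rw [h1]; exact zero_mem _)
  exact (Submodule.mem_bot ℂ).1 h2

theorem eq_top_of_valuedIn_eq_top {N : ℕ} {H : Type*} [NormedAddCommGroup H] [InnerProductSpace ℂ H]
    {I : Submodule ℂ H} (h : valuedIn N I = ⊤) : I = ⊤ := by
  refine Submodule.eq_top_iff'.2 fun v => ?_
  obtain ⟨f, hf⟩ := exists_mem_valuedIn_iff N v
  exact (hf I).1 (by rw [h]; exact Submodule.mem_top)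

end ValuedIn

/-! ### Irreducibility forces `H = ℂ`. -/

section Ideals

variable {N : ℕ} {E H : Type*}
  [NormedAddCommGroup E] [InnerProductSpace ℝ E] [CompleteSpace E]
  [Lattice E] [IsOrderedAddMonoid E] [IsOrderedModule ℝ E] [HasSolidNorm E]
  [NormedAddCommGroup H] [InnerProductSpace ℂ H] [CompleteSpace H]

theorem ComplexHilbertLattice.IsClosedIdeal.hasOrthogonalProjection
    {L : ComplexHilbertLattice E H} {I : Submodule ℂ H} (hI : L.IsClosedIdeal I) :
    I.HasOrthogonalProjection := by
  have := hI.isClosed.completeSpace_coe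
  infer_instance

theorem ComplexHilbertLattice.IsClosedIdeal.valuedIn {L : ComplexHilbertLattice E H}
    {I : Submodule ℂ H} (hI : L.IsClosedIdeal I) : IsClosedIdealL2 L (valuedIn N I) where
  isClosed := by
    have := hI.hasOrthogonalProjection
    exact isClosed_valuedIn I
  solid f hf g hgf := by
    change ∀ᵐ x, f x ∈ I at hf
    filter_upwards [hf, hgf] with x h1 h2
    exact hI.solid _ h1 _ h2

/-- An irreducible family that leaves all `L²(ℝ^N; I)` invariant can only exist for `H = ℂ`. -/
theorem IsIrreducibleFamily.isScalar [Nontrivial H] {ι : Type*} {L : ComplexHilbertLattice E H}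
    {T : ι → BochnerL2 N H → BochnerL2 N H} (hT : IsIrreducibleFamily L T)
    (hinv : ∀ I, L.IsClosedIdeal I → IsInvariantUnder T (valuedIn N I)) : L.IsScalar := by
  refine L.isScalar_of_forall_isClosedIdeal fun I hI => ?_
  rcases hT _ hI.valuedIn (hinv I hI) with h | h
  · exact Or.inl (eq_bot_of_valuedIn_eq_bot h)
  · exact Or.inr (eq_top_of_valuedIn_eq_top h)

theorem ComplexHilbertLattice.valuedIn_ne_bot_and_ne_top [Nontrivial H]
    {L : ComplexHilbertLattice E H} (hL : ¬ L.IsScalar) {I : Submodule ℂ H}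
    (hI : Module.finrank ℂ I = 1) : _root_.valuedIn N I ≠ ⊥ ∧ _root_.valuedIn N I ≠ ⊤ := by
  constructor <;> intro h
  · rw [eq_bot_of_valuedIn_eq_bot h] at hI
    simp at hI
  · rw [eq_top_of_valuedIn_eq_top h, finrank_top] at hI
    exact hL (L.isScalar_of_finrank_eq_one hI)

end Ideals

/-! ### The number `e^{-a}` as an average of characters. -/

section PoissonKernel

open FourierTransform

theorem integrableOn_Iic_cexp_neg_abs (w : ℝ) :
    IntegrableOn (fun x : ℝ => Complex.exp ((-(2 * Real.pi * x * w) : ℝ) * Complex.I) *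
      (Real.exp (-|x|) : ℝ)) (Set.Iic 0) ∧
    ∫ x : ℝ in Set.Iic 0, Complex.exp ((-(2 * Real.pi * x * w) : ℝ) * Complex.I) *
      (Real.exp (-|x|) : ℝ) = (1 - 2 * Real.pi * w * Complex.I)⁻¹ := by
  have hre : 0 < (1 - 2 * Real.pi * w * Complex.I : ℂ).re := by simp
  have heq : Set.EqOn (fun x : ℝ => Complex.exp ((1 - 2 * Real.pi * w * Complex.I) * x))
      (fun x : ℝ => Complex.exp ((-(2 * Real.pi * x * w) : ℝ) * Complex.I) *
        (Real.exp (-|x|) : ℝ)) (Set.Iic 0) := by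
    intro x hx
    simp only
    rw [abs_of_nonpos hx, neg_neg, Complex.ofReal_exp, ← Complex.exp_add]
    congr 1
    push_cast
    ring
  refine ⟨(integrableOn_exp_mul_complex_Iic hre 0).congr_fun heq measurableSet_Iic, ?_⟩
  rw [← setIntegral_congr_fun measurableSet_Iic heq, integral_exp_mul_complex_Iic hre]
  simp

theorem integrableOn_Ioi_cexp_neg_abs (w : ℝ) :
    IntegrableOn (fun x : ℝ => Complex.exp ((-(2 * Real.pi * x * w) : ℝ) * Complex.I) *
      (Real.exp (-|x|) : ℝ)) (Set.Ioi 0) ∧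
    ∫ x : ℝ in Set.Ioi 0, Complex.exp ((-(2 * Real.pi * x * w) : ℝ) * Complex.I) *
      (Real.exp (-|x|) : ℝ) = (1 + 2 * Real.pi * w * Complex.I)⁻¹ := by
  have hre : (-(1 + 2 * Real.pi * w * Complex.I) : ℂ).re < 0 := by simp
  have heq : Set.EqOn (fun x : ℝ => Complex.exp (-(1 + 2 * Real.pi * w * Complex.I) * x))
      (fun x : ℝ => Complex.exp ((-(2 * Real.pi * x * w) : ℝ) * Complex.I) *
        (Real.exp (-|x|) : ℝ)) (Set.Ioi 0) := by
    intro x hx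
    simp only
    rw [abs_of_pos hx, Complex.ofReal_exp, ← Complex.exp_add]
    congr 1
    push_cast
    ring
  refine ⟨(integrableOn_exp_mul_complex_Ioi hre 0).congr_fun heq measurableSet_Ioi, ?_⟩
  rw [← setIntegral_congr_fun measurableSet_Ioi heq, integral_exp_mul_complex_Ioi hre]
  rw [Complex.ofReal_zero, mul_zero, Complex.exp_zero, neg_div_neg_eq, one_div]

/-- On each half-line the integrand is a complex exponential; the two contributions are conjugate
and add up to the kernel. -/
theorem fourier_exp_neg_abs (w : ℝ) :
    𝓕 (fun x : ℝ => ((Real.exp (-|x|) : ℝ) : ℂ)) w =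
      ((2 * (1 + (2 * Real.pi * w) ^ 2)⁻¹ : ℝ) : ℂ) := by
  have h1 : (1 - 2 * Real.pi * w * Complex.I : ℂ) ≠ 0 := by
    intro h
    simpa using congrArg Complex.re h
  have h2 : (1 + 2 * Real.pi * w * Complex.I : ℂ) ≠ 0 := by
    intro h
    simpa using congrArg Complex.re h
  have h3 : (1 - 2 * Real.pi * w * Complex.I : ℂ) * (1 + 2 * Real.pi * w * Complex.I) =
      1 + (2 * Real.pi * w) ^ 2 := by
    linear_combination (-(2 * Real.pi * w : ℂ) ^ 2) * Complex.I_sq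
  have h4 : (1 + (2 * Real.pi * w) ^ 2 : ℂ) ≠ 0 := by
    rw [← h3]; exact mul_ne_zero h1 h2
  rw [Real.fourier_real_eq_integral_exp_smul]
  have h5 := intervalIntegral.integral_Iic_add_Ioi (integrableOn_Iic_cexp_neg_abs w).1
    (integrableOn_Ioi_cexp_neg_abs w).1
  rw [(integrableOn_Iic_cexp_neg_abs w).2, (integrableOn_Ioi_cexp_neg_abs w).2] at h5
  have h6 : ∫ x : ℝ, Complex.exp (((-2 * Real.pi * x * w : ℝ) : ℂ) * Complex.I) •
      ((Real.exp (-|x|) : ℝ) : ℂ) = (1 - 2 * Real.pi * w * Complex.I)⁻¹ +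
        (1 + 2 * Real.pi * w * Complex.I)⁻¹ := by
    rw [h5]
    refine integral_congr_ae (Eventually.of_forall fun x => ?_)
    simp only [smul_eq_mul, neg_mul]
  rw [h6, inv_add_inv h1 h2, h3]
  push_cast
  field_simp
  ring

theorem integrable_exp_neg_abs : Integrable fun x : ℝ => ((Real.exp (-|x|) : ℝ) : ℂ) := by
  have h := (integrableOn_Iic_cexp_neg_abs 0).1.union (integrableOn_Ioi_cexp_neg_abs 0).1
  rw [Set.Iic_union_Ioi, integrableOn_univ] at h
  simpa using h

theorem integrable_poissonKernel :
    Integrable fun w : ℝ => ((2 * (1 + (2 * Real.pi * w) ^ 2)⁻¹ : ℝ) : ℂ) :=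
  ((integrable_inv_one_add_sq.comp_mul_left' Real.two_pi_pos.ne').const_mul 2).ofReal

/-- Fourier inversion for `e^{-|x|}`, evaluated at `a ≥ 0`. -/
theorem cexp_neg_eq_integral_poissonKernel {a : ℝ} (ha : 0 ≤ a) :
    Complex.exp (-a) = ∫ w : ℝ, Complex.exp ((2 * Real.pi * w * a : ℝ) * Complex.I) *
      ((2 * (1 + (2 * Real.pi * w) ^ 2)⁻¹ : ℝ) : ℂ) := by
  have hF : 𝓕 (fun x : ℝ => ((Real.exp (-|x|) : ℝ) : ℂ)) =
      fun w : ℝ => ((2 * (1 + (2 * Real.pi * w) ^ 2)⁻¹ : ℝ) : ℂ) := funext fourier_exp_neg_abs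
  have hc : Continuous fun x : ℝ => ((Real.exp (-|x|) : ℝ) : ℂ) := by fun_prop
  have h := congrFun (hc.fourierInv_fourier_eq integrable_exp_neg_abs
    (by rw [hF]; exact integrable_poissonKernel)) a
  rw [hF, Real.fourierInv_eq'] at h
  simp only [abs_of_nonneg ha] at h
  rw [← Complex.ofReal_neg, ← Complex.ofReal_exp, ← h]
  refine integral_congr_ae (Eventually.of_forall fun w => ?_)
  simp only [smul_eq_mul, RCLike.inner_apply, conj_trivial]
  congr 3
  push_cast
  ring

/-- If `∫ e^{ita} h = 0` for all `t`, then `∫ e^{-a} h = 0`. -/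
theorem integral_cexp_neg_mul_eq_zero {α : Type*} [MeasurableSpace α] {μ : Measure α} [SFinite μ]
    {a : α → ℝ} (ham : Measurable a) (ha : ∀ x, 0 ≤ a x) {h : α → ℂ} (hh : Integrable h μ)
    (h0 : ∀ t : ℝ, ∫ x, Complex.exp ((t * a x : ℝ) * Complex.I) * h x ∂μ = 0) :
    ∫ x, Complex.exp (-(a x)) * h x ∂μ = 0 := by
  have h1 : ∀ x, Complex.exp (-(a x)) * h x = ∫ w : ℝ,
      Complex.exp ((2 * Real.pi * w * a x : ℝ) * Complex.I) *
        (h x * ((2 * (1 + (2 * Real.pi * w) ^ 2)⁻¹ : ℝ) : ℂ)) := by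
    intro x
    rw [cexp_neg_eq_integral_poissonKernel (ha x), ← integral_mul_const]
    refine integral_congr_ae (Eventually.of_forall fun w => ?_)
    simp only
    ring
  simp_rw [h1]
  -- Fubini applies because `h` and the kernel are integrable and the exponential has modulus one.
  -- For fixed `w` the inner integral is then the hypothesis at `t = 2πw`.
  rw [integral_integral_swap]
  · refine integral_eq_zero_of_ae (Eventually.of_forall fun w => ?_)
    simp only [Pi.zero_apply]
    have h2 := congrArg (· * ((2 * (1 + (2 * Real.pi * w) ^ 2)⁻¹ : ℝ) : ℂ)) (h0 (2 * Real.pi * w))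
    simp only [zero_mul] at h2
    rw [← integral_mul_const] at h2
    simpa only [mul_assoc] using h2
  · refine (hh.mul_prod integrable_poissonKernel).bdd_mul (c := 1) ?_ ?_
    · refine Measurable.aestronglyMeasurable ?_
      fun_prop
    · refine Eventually.of_forall fun p => ?_
      rw [Complex.norm_exp_ofReal_mul_I]

end PoissonKernel

/-! ### From the unitary group to the heat operator. -/

section UnitaryToHeat

open FourierTransform

variable {N : ℕ} {H : Type*} [NormedAddCommGroup H] [InnerProductSpace ℂ H] [CompleteSpace H]

/-- Closed subspaces invariant under the unitary group are invariant under the heat semigroup. -/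
theorem heatOp_one_mem_of_forall_schrodingerOp_mem {W : Submodule ℂ (BochnerL2 N H)}
    (hW : IsClosed (W : Set (BochnerL2 N H))) (hinv : ∀ t, ∀ f ∈ W, schrodingerOp t f ∈ W)
    {f : BochnerL2 N H} (hf : f ∈ W) : heatOp 1 f ∈ W := by
  have := hW.completeSpace_coe
  -- A closed subspace is its double orthogonal complement, so membership reduces to scalar
  -- integrals against each `g` in `Wᗮ`.
  rw [← W.orthogonal_orthogonal, Submodule.mem_orthogonal]
  intro g hg
  rw [Submodule.mem_orthogonal'] at hg
  have key : ∀ (c : ℂ) (hc : c.re ≤ 0), inner ℂ g (expLaplace c hc f) =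
      ∫ ξ, Complex.exp (c * laplaceSymbol ξ) * inner ℂ ((𝓕 g) ξ) ((𝓕 f) ξ) := by
    intro c hc
    rw [← Lp.inner_fourier_eq, L2.inner_def]
    refine integral_congr_ae ?_
    filter_upwards [fourier_expLaplace c hc f] with ξ hξ
    rw [hξ, inner_smul_right]
  have h1 := integral_cexp_neg_mul_eq_zero (continuous_laplaceSymbol (N := N)).measurable
    laplaceSymbol_nonneg (L2.integrable_inner (𝕜 := ℂ) (𝓕 g : BochnerL2 N H) (𝓕 f)) fun t => ?_
  · rw [heatOp, key, ← h1]
    refine integral_congr_ae (Eventually.of_forall fun ξ => ?_)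
    simp
  · have h2 := hg _ (hinv (-t) f hf)
    rw [schrodingerOp_apply, schrodingerCLM, key] at h2
    rw [← h2]
    refine integral_congr_ae (Eventually.of_forall fun ξ => ?_)
    simp only
    congr 2
    push_cast
    ring

end UnitaryToHeat

/-! ### The Fourier integral on `L¹ ∩ L²`. -/

section IntegrableFourier

open FourierTransform

variable {V H : Type*} [NormedAddCommGroup V] [InnerProductSpace ℝ V] [FiniteDimensional ℝ V]
  [MeasurableSpace V] [BorelSpace V]
  [NormedAddCommGroup H] [InnerProductSpace ℂ H] [CompleteSpace H]

theorem continuous_fourier_of_integrable {V H : Type*} [NormedAddCommGroup V]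
    [InnerProductSpace ℝ V] [FiniteDimensional ℝ V] [MeasurableSpace V] [BorelSpace V]
    [NormedAddCommGroup H] [InnerProductSpace ℂ H] {f : V → H} (hf : Integrable f) :
    Continuous (𝓕 f) :=
  VectorFourier.fourierIntegral_continuous Real.continuous_fourierChar
    (L := innerₗ V) continuous_inner hf

/-- On `L¹ ∩ L²` the Fourier transform of `L²` is given by the Fourier integral. -/
theorem Lp_fourier_ae_eq_of_integrable (f : Lp H 2 (volume : Measure V)) (hf : Integrable f) :
    (𝓕 f : Lp H 2 (volume : Measure V)) =ᵐ[volume] 𝓕 (f : V → H) := by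
  have h1 : LocallyIntegrable (fun x => (𝓕 f : Lp H 2 (volume : Measure V)) x) volume :=
    (Lp.memLp _).locallyIntegrable (by norm_num)
  refine ae_eq_of_integral_contDiff_smul_eq h1
    (continuous_fourier_of_integrable hf).locallyIntegrable fun φ hφ hφc => ?_
  have hc : HasCompactSupport (Complex.ofRealCLM ∘ φ) := hφc.comp_left rfl
  have hd : ContDiff ℝ (⊤ : ℕ∞) (Complex.ofRealCLM ∘ φ) := by fun_prop
  set u : 𝓢(V, ℂ) := hc.toSchwartzMap hd
  have hu : ∀ x, u x = (φ x : ℂ) := fun x => rfl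
  have h2 := congrArg (fun T : 𝓢'(V, H) => T u) (Lp.fourier_toTemperedDistribution_eq f)
  simp only [TemperedDistribution.fourier_apply, Lp.toTemperedDistribution_apply] at h2
  have h3 : ∫ x, (𝓕 u) x • f x = ∫ x, u x • 𝓕 (f : V → H) x := by
    have h4 := VectorFourier.integral_fourierIntegral_smul_eq_flip (μ := volume) (ν := volume)
      (L := innerₗ V) (f := u) (g := f) Real.continuous_fourierChar continuous_inner u.integrable hf
    rw [flip_innerₗ] at h4
    rw [SchwartzMap.fourier_coe]
    exact h4
  rw [h3] at h2
  simp only [hu, Complex.coe_smul] at h2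
  exact h2.symm

end IntegrableFourier

/-! ### The heat operator as a Gaussian convolution. -/

section Gaussian

open FourierTransform Convolution

variable {N : ℕ} {H : Type*} [NormedAddCommGroup H] [InnerProductSpace ℂ H] [CompleteSpace H]

/-- The heat kernel at time one, up to a positive factor. -/
noncomputable def gaussian {N : ℕ} (x : EuclideanSpace ℝ (Fin N)) : ℝ :=
  Real.exp (-(1 / 4) * ‖x‖ ^ 2)

theorem gaussian_pos (x : EuclideanSpace ℝ (Fin N)) : 0 < gaussian x := Real.exp_pos _

theorem gaussian_le_one (x : EuclideanSpace ℝ (Fin N)) : gaussian x ≤ 1 :=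
  Real.exp_le_one_iff.2 (by nlinarith [sq_nonneg ‖x‖])

theorem continuous_gaussian : Continuous (gaussian (N := N)) := by
  unfold gaussian; fun_prop

theorem ofReal_gaussian (x : EuclideanSpace ℝ (Fin N)) :
    (gaussian x : ℂ) = Complex.exp (-((1 / 4 : ℝ) : ℂ) * ‖x‖ ^ 2) := by
  unfold gaussian
  push_cast
  rfl

theorem integrable_ofReal_gaussian :
    Integrable fun x : EuclideanSpace ℝ (Fin N) => (gaussian x : ℂ) := by
  have := GaussianFourier.integrable_cexp_neg_mul_sq_norm_add
    (V := EuclideanSpace ℝ (Fin N)) (b := ((1 / 4 : ℝ) : ℂ)) (by simp) 0 0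
  simpa only [ofReal_gaussian, zero_mul, add_zero] using this

theorem integrable_gaussian : Integrable (gaussian (N := N)) := by
  simpa using (integrable_ofReal_gaussian (N := N)).re

/-- The exponent `1/4` is chosen so that `π²‖ξ‖² / (1/4)` is exactly the Laplace symbol. Only the
nonvanishing of the factor `K` is recorded. -/
theorem exists_fourier_gaussian_eq : ∃ K : ℂ, K ≠ 0 ∧ ∀ ξ : EuclideanSpace ℝ (Fin N),
    𝓕 (fun x : EuclideanSpace ℝ (Fin N) => (gaussian x : ℂ)) ξ =
      K * Complex.exp (-(laplaceSymbol ξ : ℂ)) := by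
  refine ⟨((Real.pi : ℂ) / ((1 / 4 : ℝ) : ℂ)) ^
    (Module.finrank ℝ (EuclideanSpace ℝ (Fin N)) / 2 : ℂ), ?_, fun ξ => ?_⟩
  · rw [Complex.cpow_ne_zero_iff]
    left
    simp [Real.pi_ne_zero]
  · simp only [ofReal_gaussian]
    rw [fourier_gaussian_innerProductSpace (by simp)]
    congr 2
    unfold laplaceSymbol
    push_cast
    ring

/-- Convolution of an integrable function in `L²` with the Gaussian gives the heat semigroup. -/
theorem exists_heatOp_one_eq_convolution (f : BochnerL2 N H) (hf : Integrable f) :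
    ∃ K : ℂ, K ≠ 0 ∧ (K • heatOp 1 f : BochnerL2 N H) =ᵐ[volume]
      fun x => ∫ t, (gaussian (x - t) : ℂ) • f t := by
  obtain ⟨K, hK, hF⟩ := exists_fourier_gaussian_eq (N := N)
  set G : EuclideanSpace ℝ (Fin N) → ℂ := fun x => (gaussian x : ℂ) with hG
  have hGi : Integrable G := integrable_ofReal_gaussian
  -- Scalar multiplication is flipped because the vector-valued factor comes first in the
  -- convolution.
  set B : H →L[ℂ] ℂ →L[ℂ] H := (ContinuousLinearMap.lsmul ℂ ℂ).flip with hB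
  set k : EuclideanSpace ℝ (Fin N) → H := (f : EuclideanSpace ℝ (Fin N) → H) ⋆[B] G with hk
  have hkx : ∀ x, k x = ∫ t, (gaussian (x - t) : ℂ) • f t := fun x => rfl
  have hki : Integrable k := hf.integrable_convolution B hGi
  have hkb : ∀ x, ‖k x‖ ≤ ∫ t, ‖f t‖ := by
    intro x
    rw [hkx]
    refine norm_integral_le_of_norm_le hf.norm (Eventually.of_forall fun t => ?_)
    rw [norm_smul, Complex.norm_real, Real.norm_of_nonneg (gaussian_pos _).le]
    exact mul_le_of_le_one_left (norm_nonneg _) (gaussian_le_one _)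
  -- A bounded integrable function is square integrable: `‖k‖²` is at most the bound times `‖k‖`.
  have hk2 : MemLp k 2 volume := by
    rw [memLp_two_iff_integrable_sq_norm hki.1]
    refine (hki.norm.const_mul (∫ t, ‖f t‖)).mono' (hki.1.norm.pow 2)
      (Eventually.of_forall fun x => ?_)
    rw [Real.norm_of_nonneg (by positivity), sq]
    exact mul_le_mul_of_nonneg_right (hkb x) (norm_nonneg _)
  have hkk := hk2.coeFn_toLp
  refine ⟨K, hK, ?_⟩
  have heq : (K • heatOp 1 f : BochnerL2 N H) = hk2.toLp k := by
    refine Lp_ext_fourier ?_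
    have hsm : (𝓕 (K • heatOp 1 f) : BochnerL2 N H) = K • 𝓕 (heatOp 1 f) :=
      (Lp.fourierTransformₗᵢ (EuclideanSpace ℝ (Fin N)) H).map_smul _ _
    have hint : Integrable (hk2.toLp k) := hki.congr hkk.symm
    have hFk : 𝓕 (hk2.toLp k : EuclideanSpace ℝ (Fin N) → H) = 𝓕 k := by
      funext ξ
      rw [Real.fourier_eq, Real.fourier_eq]
      refine integral_congr_ae ?_
      filter_upwards [hkk] with x hx
      rw [hx]
    filter_upwards [Lp_fourier_ae_eq_of_integrable _ hint, Lp_fourier_ae_eq_of_integrable f hf,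
      fourier_expLaplace _ (heat_re_nonpos 1) f, Lp.coeFn_smul K (𝓕 (heatOp 1 f))]
      with ξ h1 h2 h3 h4
    rw [hsm, h4, h1, hFk, hk, Real.fourier_bilin_convolution_eq B hf hGi, Pi.smul_apply]
    simp only [heatOp]
    rw [h3, ← h2, hB, ContinuousLinearMap.flip_apply, ContinuousLinearMap.lsmul_apply, hG, hF,
      smul_smul]
    simp
  rw [heq]
  exact hkk.trans (Eventually.of_forall hkx)

end Gaussian

/-! ### Norm-solid subspaces invariant under the heat operator. -/

section NormIdeals

/-- A closed subspace of `L²` that is solid with respect to pointwise norms and contains an almost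
everywhere nonzero function is the whole space. -/
theorem eq_top_of_solid_of_ae_ne_zero {α H : Type*} [MeasurableSpace α] {μ : Measure α}
    [NormedAddCommGroup H] [InnerProductSpace ℂ H] {W : Submodule ℂ (Lp H 2 μ)}
    (hW : IsClosed (W : Set (Lp H 2 μ)))
    (hsolid : ∀ f ∈ W, ∀ g : Lp H 2 μ, (∀ᵐ x ∂μ, ‖g x‖ ≤ ‖f x‖) → g ∈ W)
    {k : Lp H 2 μ} (hk : k ∈ W) (hk0 : ∀ᵐ x ∂μ, k x ≠ 0) : W = ⊤ := by
  refine Submodule.eq_top_iff'.2 fun g => ?_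
  -- On `S n` the function `g` is dominated by `n k`, so its truncation lies in `W`; where `k ≠ 0`
  -- every point eventually belongs to `S n`.
  set S : ℕ → Set α := fun n => {x | ‖g x‖ ≤ n * ‖k x‖} with hS
  have hSm : ∀ n, MeasurableSet (S n) := fun n =>
    (Lp.stronglyMeasurable g).norm.measurableSet_le ((Lp.stronglyMeasurable k).norm.const_mul _)
  have hmem : ∀ n, MemLp ((S n).indicator g) 2 μ := fun n => (Lp.memLp g).indicator (hSm n)
  have hW' : ∀ n, (hmem n).toLp _ ∈ W := by
    intro n
    refine hsolid _ (W.smul_mem (n : ℂ) hk) _ ?_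
    filter_upwards [(hmem n).coeFn_toLp, Lp.coeFn_smul (n : ℂ) k] with x h1 h2
    rw [h1, h2, Pi.smul_apply, norm_smul, Complex.norm_natCast]
    by_cases hx : x ∈ S n
    · rw [Set.indicator_of_mem hx]
      exact hx
    · rw [Set.indicator_of_notMem hx, norm_zero]
      positivity
  refine hW.mem_of_tendsto (b := atTop) (f := fun n => (hmem n).toLp _) ?_
    (Eventually.of_forall hW')
  refine tendsto_Lp_of_dominated (fun x => ‖g x‖) (Lp.memLp g).norm
    (Eventually.of_forall fun n => (hmem n).coeFn_toLp)
    (Eventually.of_forall fun n => Eventually.of_forall fun x => norm_indicator_le_norm_self _ _) ?_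
  filter_upwards [hk0] with x hx
  obtain ⟨n₀, hn₀⟩ := exists_nat_ge (‖g x‖ / ‖k x‖)
  refine tendsto_const_nhds.congr' ?_
  filter_upwards [eventually_ge_atTop n₀] with n hn
  have : x ∈ S n := by
    have hpos := norm_pos_iff.2 hx
    have h1 : (n₀ : ℝ) ≤ n := by exact_mod_cast hn
    exact (div_le_iff₀ hpos).1 (hn₀.trans h1)
  rw [Set.indicator_of_mem this]

variable {N : ℕ} {H : Type*} [NormedAddCommGroup H] [InnerProductSpace ℂ H] [CompleteSpace H]

/-- The heat semigroup sends nonzero nonnegative functions to strictly positive ones. -/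
theorem heatOp_one_ae_ne_zero {φ : EuclideanSpace ℝ (Fin N) → ℝ} (hφ : Integrable φ)
    (h0 : ∀ x, 0 ≤ φ x) (hne : ¬ φ =ᵐ[volume] 0) {e : H} (he : e ≠ 0) {f : BochnerL2 N H}
    (hf : f =ᵐ[volume] fun x => φ x • e) : ∀ᵐ x, heatOp 1 f x ≠ 0 := by
  have hfi : Integrable f := (hφ.smul_const e).congr hf.symm
  obtain ⟨K, -, hKf⟩ := exists_heatOp_one_eq_convolution f hfi
  filter_upwards [hKf, Lp.coeFn_smul K (heatOp 1 f)] with x h1 h2 h3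
  rw [h2, Pi.smul_apply, h3, smul_zero] at h1
  have h4 : ∫ t, (gaussian (x - t) : ℂ) • f t = (∫ t, gaussian (x - t) * φ t) • e := by
    rw [← integral_smul_const]
    refine integral_congr_ae ?_
    filter_upwards [hf] with t ht
    rw [ht, Complex.coe_smul, smul_smul]
  rw [h4, eq_comm, smul_eq_zero_iff_left he] at h1
  have hint : Integrable fun t => gaussian (x - t) * φ t := by
    refine hφ.bdd_mul (c := 1)
      (continuous_gaussian.comp (continuous_sub_left x)).aestronglyMeasurable
      (Eventually.of_forall fun t => ?_)
    rw [Real.norm_of_nonneg (gaussian_pos _).le]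
    exact gaussian_le_one _
  rw [integral_eq_zero_iff_of_nonneg (fun t => mul_nonneg (gaussian_pos _).le (h0 t)) hint] at h1
  refine hne ?_
  filter_upwards [h1] with t ht
  exact (mul_eq_zero.1 ht).resolve_left (gaussian_pos _).ne'

/-- Subspaces of `L²` that are solid with respect to pointwise norms are trivial if they are
invariant under the heat semigroup. -/
theorem eq_bot_or_eq_top_of_solid_of_heatOp_mem [Nontrivial H]
    {W : Submodule ℂ (BochnerL2 N H)} (hW : IsClosed (W : Set (BochnerL2 N H)))
    (hsolid : ∀ f ∈ W, ∀ g : BochnerL2 N H, (∀ᵐ x, ‖g x‖ ≤ ‖f x‖) → g ∈ W)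
    (hinv : ∀ f ∈ W, heatOp 1 f ∈ W) : W = ⊥ ∨ W = ⊤ := by
  rcases eq_or_ne W ⊥ with h | h
  · exact Or.inl h
  right
  obtain ⟨f, hf, hf0⟩ := W.ne_bot_iff.1 h
  obtain ⟨e, he⟩ := exists_norm_eq H zero_le_one
  have he0 : e ≠ 0 := norm_ne_zero_iff.1 (by rw [he]; exact one_ne_zero)
  -- The minimum stays below `‖f‖`, so `φ e` lies in `W`. The Gaussian makes it integrable, and
  -- being positive it does not enlarge the zero set of `f`.
  set φ : EuclideanSpace ℝ (Fin N) → ℝ := fun x => min ‖f x‖ (gaussian x) with hφ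
  have hφ0 : ∀ x, 0 ≤ φ x := fun x => le_min (norm_nonneg _) (gaussian_pos x).le
  have hφm : AEStronglyMeasurable φ volume :=
    (Lp.aestronglyMeasurable f).norm.inf continuous_gaussian.aestronglyMeasurable
  have hφi : Integrable φ := integrable_gaussian.mono' hφm (Eventually.of_forall fun x => by
    rw [Real.norm_of_nonneg (hφ0 x)]
    exact min_le_right _ _)
  have hφn : ∀ x, ‖φ x • e‖ = φ x := fun x => by
    rw [norm_smul, he, mul_one, Real.norm_of_nonneg (hφ0 x)]
  have hmem : MemLp (fun x => φ x • e) 2 volume :=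
    (Lp.memLp f).of_le (hφm.smul_const e) (Eventually.of_forall fun x => by
      rw [hφn]
      exact min_le_left _ _)
  have hne : ¬ φ =ᵐ[volume] 0 := by
    intro h0
    refine hf0 ((Lp.eq_zero_iff_ae_eq_zero).2 ?_)
    filter_upwards [h0] with x hx
    rcases min_choice ‖f x‖ (gaussian x) with h1 | h1
    · exact norm_eq_zero.1 (h1.symm.trans hx)
    · exact absurd (h1.symm.trans hx) (gaussian_pos x).ne'
  have hW' : hmem.toLp _ ∈ W := by
    refine hsolid f hf _ ?_
    filter_upwards [hmem.coeFn_toLp] with x hx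
    rw [hx, hφn]
    exact min_le_left _ _
  exact eq_top_of_solid_of_ae_ne_zero hW hsolid (hinv _ hW')
    (heatOp_one_ae_ne_zero hφi hφ0 hne he0 hmem.coeFn_toLp)

end NormIdeals

/-! ### The irreducibility criteria. -/

section Irreducibility

variable {N : ℕ} {E H : Type*}
  [NormedAddCommGroup E] [InnerProductSpace ℝ E] [CompleteSpace E]
  [Lattice E] [IsOrderedAddMonoid E] [IsOrderedModule ℝ E] [HasSolidNorm E]
  [NormedAddCommGroup H] [InnerProductSpace ℂ H] [CompleteSpace H]

theorem IsClosedIdealL2.eq_bot_or_eq_top_of_isScalar [Nontrivial H] {L : ComplexHilbertLattice E H}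
    (hL : L.IsScalar) {W : Submodule ℂ (BochnerL2 N H)} (hW : IsClosedIdealL2 L W)
    (hinv : ∀ f ∈ W, heatOp 1 f ∈ W) : W = ⊥ ∨ W = ⊤ := by
  refine eq_bot_or_eq_top_of_solid_of_heatOp_mem hW.isClosed (fun f hf g hgf => ?_) hinv
  refine hW.solid f hf g ?_
  filter_upwards [hgf] with x hx
  exact (hL.modulus_le_iff _ _).2 hx

theorem IsSemigroupGeneratedBy.eq_heatOp {T : ℝ≥0 → BochnerL2 N H →L[ℂ] BochnerL2 N H}
    (hT : IsSemigroupGeneratedBy IsLaplacian T) (t : ℝ≥0) (f : BochnerL2 N H) :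
    T t f = heatOp t f :=
  hT.commute_of_commute isDissipative_laplacian heatOp_isSemigroupGeneratedBy
    (ContinuousLinearMap.id ℂ _) (fun _ _ h => h) t f

theorem IsUnitaryGroupGeneratedBy.eq_schrodingerOp
    {U : ℝ → BochnerL2 N H ≃ₗᵢ[ℂ] BochnerL2 N H} (hU : IsUnitaryGroupGeneratedBy IsLaplacian U)
    (t : ℝ) (f : BochnerL2 N H) : U t f = schrodingerOp t f :=
  hU.commute_of_commute isDissipative_laplacian schrodingerOp_isUnitaryGroupGeneratedBy
    (ContinuousLinearMap.id ℂ _) (fun _ _ h => h) t f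

theorem isIrreducibleFamily_semigroup_iff [Nontrivial H] (L : ComplexHilbertLattice E H)
    {T : ℝ≥0 → BochnerL2 N H →L[ℂ] BochnerL2 N H} (hT : IsSemigroupGeneratedBy IsLaplacian T) :
    IsIrreducibleFamily L (fun t f => T t f) ↔ L.IsScalar := by
  constructor
  · intro h
    refine h.isScalar fun I hI => ?_
    have := hI.hasOrthogonalProjection
    exact isInvariantUnder_semigroup_valuedIn I hT
  · intro hL W hW hinv
    refine hW.eq_bot_or_eq_top_of_isScalar hL fun f hf => ?_
    rw [← hT.eq_heatOp]
    exact hinv 1 f hf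

theorem isIrreducibleFamily_unitaryGroup_iff [Nontrivial H] (L : ComplexHilbertLattice E H)
    {U : ℝ → BochnerL2 N H ≃ₗᵢ[ℂ] BochnerL2 N H}
    (hU : IsUnitaryGroupGeneratedBy IsLaplacian U) :
    IsIrreducibleFamily L (fun t f => U t f) ↔ L.IsScalar := by
  constructor
  · intro h
    refine h.isScalar fun I hI => ?_
    have := hI.hasOrthogonalProjection
    exact isInvariantUnder_unitaryGroup_valuedIn I hU
  · intro hL W hW hinv
    refine hW.eq_bot_or_eq_top_of_isScalar hL fun f hf => ?_
    refine heatOp_one_mem_of_forall_schrodingerOp_mem hW.isClosed (fun t k hk => ?_) hf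
    rw [← hU.eq_schrodingerOp]
    exact hinv t k hk

end Irreducibility

theorem mainTheorem5 {N : ℕ} {E H : Type*}
    [NormedAddCommGroup E] [InnerProductSpace ℝ E] [CompleteSpace E]
    [Lattice E] [IsOrderedAddMonoid E] [IsOrderedModule ℝ E] [HasSolidNorm E]
    [NormedAddCommGroup H] [InnerProductSpace ℂ H] [CompleteSpace H]
    [TopologicalSpace.SeparableSpace H] [Nontrivial H]
    (L : ComplexHilbertLattice E H) :
    (∃ T : ℝ≥0 → BochnerL2 N H →L[ℂ] BochnerL2 N H, IsSemigroupGeneratedBy IsLaplacian T) ∧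
    (∃ U : ℝ → BochnerL2 N H ≃ₗᵢ[ℂ] BochnerL2 N H, IsUnitaryGroupGeneratedBy IsLaplacian U) ∧
    ∀ (T : ℝ≥0 → BochnerL2 N H →L[ℂ] BochnerL2 N H)
      (U : ℝ → BochnerL2 N H ≃ₗᵢ[ℂ] BochnerL2 N H),
      IsSemigroupGeneratedBy IsLaplacian T → IsUnitaryGroupGeneratedBy IsLaplacian U →
      (IsIrreducibleFamily L (fun t f => T t f) ↔ L.IsScalar) ∧
      (IsIrreducibleFamily L (fun t f => U t f) ↔ L.IsScalar) ∧
      ∀ I : Submodule ℂ H, L.IsClosedIdeal I →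
        IsClosedIdealL2 L (valuedIn N I) ∧
        IsInvariantUnder (fun t f => T t f) (valuedIn N I) ∧
        IsInvariantUnder (fun t f => U t f) (valuedIn N I) ∧
        (¬ L.IsScalar → Module.finrank ℂ I = 1 →
          valuedIn N I ≠ ⊥ ∧ valuedIn N I ≠ ⊤) := by
  refine ⟨⟨heatOp, heatOp_isSemigroupGeneratedBy⟩,
    ⟨schrodingerOp, schrodingerOp_isUnitaryGroupGeneratedBy⟩, fun T U hT hU =>
    ⟨isIrreducibleFamily_semigroup_iff L hT, isIrreducibleFamily_unitaryGroup_iff L hU,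
      fun I hI => ?_⟩⟩
  have := hI.hasOrthogonalProjection
  exact ⟨hI.valuedIn, isInvariantUnder_semigroup_valuedIn I hT,
    isInvariantUnder_unitaryGroup_valuedIn I hU,
    fun hL h1 => L.valuedIn_ne_bot_and_ne_top hL h1⟩
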